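/- Let $c\in\mathbb R\setminus\{1,-1\}$, let $p\ge 2$ be an integer, let $\sigma\in\{1,-1\}$ and $e\in\{1,-1\}$, and put $\gamma=\sqrt{|1-c^2|}$ (so $\gamma=\sqrt{1-c^2}$ if $|c|<1$ and $\gamma=\sqrt{c^2-1}$ if $|c|>1$). Let $u_0=(x+\mathrm i0)^\lambda\in\mathcal S'(\mathbb R)$ with $\lambda=\frac{2}{1-p}$, that is, the limit in $\mathcal S'(\mathbb R)$ of $(x+\mathrm i\varepsilon)^\lambda$ (principal branch) as $\varepsilon\downarrow0$; this limit exists. Then there is a constant $A\in\mathbb C\setminus\{0\}$ such that the complex-valued distribution $$u(x,t)=A\,u_0\!\left(\frac{e\,x+ct}{\gamma}\right)\quad\text{on }\mathbb R^2$$ has the following properties. 1. $u$ is a distributional solution of $\partial_t^2u-\partial_x^2u=\sigma u^p$ on $\mathbb R^2$, where $u^p$ is obtained by the successive products $u^j\cdot u$, $1\le j<p$, each of which exists both as a Fourier product $\mathcal F^{-1}(\mathcal F u^j*\mathcal F u)$ (with the $\mathcal S'$-convolution) and in the sense of Hörmander's wave front set criterion, with the same value. 2. The singular support of $u$ is the line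 $\{(x,t): e\,x+ct=0\}$ (for $e=1$: the line $\{x+ct=0\}$), and the singular support of the initial datum $u(\cdot,0)$ is $\{0\}$. 3. For every $s<\frac12-\frac{2}{p-1}$ and every $T>0$, $u\in\mathcal C([-T,T]:H^s_{\rm loc}(\mathbb R))\cap\mathcal C^1([-T,T]:H^{s-1}_{\rm loc}(\mathbb R))$, with $\partial_tu(\cdot,t)=A\,\frac{c}{\gamma}\,u_0'\!\left(\frac{e\,x+ct}{\gamma}\right)$. In particular, for any $c\neq\pm1$, any $s<\frac12$, either sign $\pm$, and all sufficiently large $p$ (those with $s<\frac12-\frac{2}{p-1}$), there are $H^s_{\rm loc}$-solutions of $\partial_t^2u-\partial_x^2u=\pm u^p$ whose singular support is the line $\{x+ct=0\}$. -/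

import Mathlib

open MeasureTheory Filter Topology FourierTransform SchwartzMap TemperedDistribution

open scoped LineDeriv ContDiff

noncomputable section

namespace AnomalousWave

/-! ### General notions for tempered distributions -/

section General

variable {E : Type*} [NormedAddCommGroup E] [InnerProductSpace ℝ E] [FiniteDimensional ℝ E]
  [MeasurableSpace E] [BorelSpace E]

/-- The singular support: the complement of the largest open set on which `u` is given by a
`C^∞` function. -/
def singularSupport (u : 𝓢'(E, ℂ)) : Set E :=
  {x | ¬ ∃ Ω : Set E, IsOpen Ω ∧ x ∈ Ω ∧ ∃ f : E → ℂ, ContDiffOn ℝ ∞ f Ω ∧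
    ∀ φ : 𝓢(E, ℂ), HasCompactSupport φ → tsupport φ ⊆ Ω → u φ = ∫ y, φ y * f y}

/-- `T` belongs to `𝒟'_{L¹}`: it is continuous for the seminorms `sup |∂^α φ|` of the space of
smooth functions vanishing at infinity with all derivatives (in which `𝓢` is dense). -/
def IsIntegrableDistribution (T : 𝓢'(E, ℂ)) : Prop :=
  ∃ (m : ℕ) (C : ℝ), ∀ φ : 𝓢(E, ℂ),
    ‖T φ‖ ≤ C * ∑ k ∈ Finset.range (m + 1), SchwartzMap.seminorm ℂ 0 k φ

/-- A sequence in `𝓢` that is bounded together with each derivative, and that is eventually equal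
to `1` on each compact set. -/
def IsApproximateUnit (χ : ℕ → 𝓢(E, ℂ)) : Prop :=
  (∀ k : ℕ, ∃ C : ℝ, ∀ n, SchwartzMap.seminorm ℂ 0 k (χ n) ≤ C) ∧
    ∀ K : Set E, IsCompact K → ∀ᶠ n in atTop, ∀ x ∈ K, χ n x = 1

/-- `⟨T, 1⟩ = I`, for `T ∈ 𝒟'_{L¹}`. -/
def HasTotalMass (T : 𝓢'(E, ℂ)) (I : ℂ) : Prop :=
  ∀ χ : ℕ → 𝓢(E, ℂ), IsApproximateUnit χ → Tendsto (fun n ↦ T (χ n)) atTop (𝓝 I)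

/-- The function `φ * S⁻`, that is `x ↦ ⟨S(y), φ(x + y)⟩`, where `S⁻(y) = S(-y)`. -/
def convReflect (φ : 𝓢(E, ℂ)) (S : 𝓢'(E, ℂ)) (x : E) : ℂ :=
  S (SchwartzMap.compSubConstCLM ℂ (-x) φ)

/-- The `𝓢'`-convolution of `S` and `T` exists and equals `W`: for all `φ ∈ 𝓢` the distribution
`(φ * S⁻) T` belongs to `𝒟'_{L¹}`, and `⟨W, φ⟩ = ⟨(φ * S⁻) T, 1⟩`. -/
def IsTemperedConvolution (S T W : 𝓢'(E, ℂ)) : Prop :=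
  ∀ φ : 𝓢(E, ℂ), IsIntegrableDistribution (smulLeftCLM ℂ (convReflect φ S) T) ∧
    HasTotalMass (smulLeftCLM ℂ (convReflect φ S) T) (W φ)

/-- The Fourier product `u · v = 𝓕⁻¹(𝓕 u * 𝓕 v)` exists and equals `w`. -/
def IsFourierProduct (u v w : 𝓢'(E, ℂ)) : Prop :=
  IsTemperedConvolution (𝓕 u) (𝓕 v) (𝓕 w)

/-- The Fourier transform of `χ u`, for `χ` with compact support, as a function:
`ξ ↦ ⟨u, χ e^{-2πi⟨·, ξ⟩}⟩`. -/
def localFourier (u : 𝓢'(E, ℂ)) (χ : 𝓢(E, ℂ)) (ξ : E) : ℂ :=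
  u (SchwartzMap.smulLeftCLM ℂ
    (fun x : E ↦ Complex.exp (-2 * Real.pi * Complex.I * (inner ℝ x ξ : ℝ))) χ)

/-- The wave front set of `u`. -/
def waveFrontSet (u : 𝓢'(E, ℂ)) : Set (E × E) :=
  {z | z.2 ≠ 0 ∧ ¬ ∃ χ : 𝓢(E, ℂ), HasCompactSupport χ ∧ χ z.1 ≠ 0 ∧
    ∃ V : Set E, IsOpen V ∧ z.2 ∈ V ∧ (∀ r : ℝ, 0 < r → ∀ η ∈ V, r • η ∈ V) ∧
      ∀ N : ℕ, ∃ C : ℝ, ∀ η ∈ V, ‖localFourier u χ η‖ * (1 + ‖η‖) ^ N ≤ C}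

/-- Hörmander's criterion: `(x, ξ) ∈ WF(u)` implies `(x, -ξ) ∉ WF(v)`. -/
def HormanderCriterion (u v : 𝓢'(E, ℂ)) : Prop :=
  ∀ x ξ : E, ξ ≠ 0 → (x, ξ) ∈ waveFrontSet u → (x, -ξ) ∉ waveFrontSet v

/-- Hörmander's product of `u` and `v` is defined and equals `w`: the wave front sets satisfy the
criterion, and near each point `w` is computed by the convolution of the Fourier transforms
of `χ u` and `χ v` (an absolutely convergent integral), for a cut-off `χ` at that point. -/
def IsHormanderProduct (u v w : 𝓢'(E, ℂ)) : Prop :=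
  HormanderCriterion u v ∧
    ∀ x : E, ∃ χ : 𝓢(E, ℂ), HasCompactSupport χ ∧ (∀ᶠ y in 𝓝 x, χ y = 1) ∧
      ∀ ξ : E, Integrable (fun η ↦ localFourier u χ η * localFourier v χ (ξ - η)) ∧
        localFourier w (SchwartzMap.smulLeftCLM ℂ χ χ) ξ =
          ∫ η, localFourier u χ η * localFourier v χ (ξ - η)

/-- `IsPower u k w`: the `k`-th power of `u` is defined and equals `w`, where each of the successive
products `u^j · u` exists both as a Fourier product and as a product in the sense of Hörmander
(with the same value). -/
inductive IsPower (u : 𝓢'(E, ℂ)) : ℕ → 𝓢'(E, ℂ) → Prop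
  | one : IsPower u 1 u
  | succ {k : ℕ} {v w : 𝓢'(E, ℂ)} : IsPower u k v → IsFourierProduct v u w →
      IsHormanderProduct v u w → IsPower u (k + 1) w

end General

/-! ### Distributions on the line -/

/-- `U = (x + i0)^l`, the limit of `(x + iε)^l` (principal branch) in `𝓢'` as `ε ↓ 0`. -/
def IsXPlusI0Pow (l : ℝ) (U : 𝓢'(ℝ, ℂ)) : Prop :=
  ∀ φ : 𝓢(ℝ, ℂ),
    Tendsto (fun ε : ℝ ↦ ∫ x : ℝ, φ x * ((x : ℂ) + ε * Complex.I) ^ (l : ℂ)) (𝓝[>] 0) (𝓝 (U φ))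

/-- The change of variables `U(a x + b)`, that is `φ ↦ |a|⁻¹ ⟨U, φ((· - b) / a)⟩`, for `a ≠ 0`
(and `0` for `a = 0`). -/
def affinePullback (a b : ℝ) (U : 𝓢'(ℝ, ℂ)) : 𝓢'(ℝ, ℂ) :=
  if h : a = 0 then 0 else
    ((|a|⁻¹ : ℝ) : ℂ) • PointwiseConvergenceCLM.precomp ℂ
      ((SchwartzMap.compSubConstCLM ℂ b).comp
        (SchwartzMap.compCLMOfContinuousLinearEquiv ℂ
          (ContinuousLinearEquiv.unitsEquivAut ℝ (Units.mk0 a h)⁻¹))) U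

theorem affinePullback_apply {a : ℝ} (ha : a ≠ 0) (b : ℝ) (U : 𝓢'(ℝ, ℂ)) (φ ψ : 𝓢(ℝ, ℂ))
    (h : ∀ x, ψ x = φ ((x - b) / a)) : affinePullback a b U φ = ((|a|⁻¹ : ℝ) : ℂ) * U ψ := by
  simp only [affinePullback, ha, dite_false]
  change ((|a|⁻¹ : ℝ) : ℂ) * U _ = _
  congr 2
  ext x
  rw [h]
  simp [div_eq_mul_inv]

/-- `U ∈ C(I : H^s_loc(ℝ))`: for each test function `ψ`, the map `t ↦ ψ U(t)` is continuous into
`H^s(ℝ)`. (The Bessel potential of order `s` identifies `H^s` with `L²` isometrically.) -/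
def ContinuousIntoHloc (s : ℝ) (I : Set ℝ) (U : ℝ → 𝓢'(ℝ, ℂ)) : Prop :=
  ∀ ψ : ℝ → ℂ, ContDiff ℝ ∞ ψ → HasCompactSupport ψ →
    ∃ g : ℝ → Lp ℂ 2 (volume : Measure ℝ), ContinuousOn g I ∧
      ∀ t ∈ I, besselPotential ℝ ℂ s (smulLeftCLM ℂ ψ (U t)) = (g t : 𝓢'(ℝ, ℂ))

/-- `V` is the derivative of `U` on `I` in `H^s_loc(ℝ)`: for each test function `ψ`, the map
`t ↦ ψ U(t)` is differentiable into `H^s(ℝ)` with derivative `t ↦ ψ V(t)`. -/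
def HasDerivIntoHloc (s : ℝ) (I : Set ℝ) (U V : ℝ → 𝓢'(ℝ, ℂ)) : Prop :=
  ∀ ψ : ℝ → ℂ, ContDiff ℝ ∞ ψ → HasCompactSupport ψ →
    ∃ g g' : ℝ → Lp ℂ 2 (volume : Measure ℝ),
      (∀ t ∈ I, besselPotential ℝ ℂ s (smulLeftCLM ℂ ψ (U t)) = (g t : 𝓢'(ℝ, ℂ))) ∧
      (∀ t ∈ I, besselPotential ℝ ℂ s (smulLeftCLM ℂ ψ (V t)) = (g' t : 𝓢'(ℝ, ℂ))) ∧
      ∀ t ∈ I, HasDerivWithinAt g (g' t) I t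

/-- `U ∈ C¹(I : H^s_loc(ℝ))` with `∂ₜ U = V`. -/
def C1IntoHloc (s : ℝ) (I : Set ℝ) (U V : ℝ → 𝓢'(ℝ, ℂ)) : Prop :=
  HasDerivIntoHloc s I U V ∧ ContinuousIntoHloc s I V

/-! ### Distributions on space-time -/

/-- Space-time `ℝ²`: the coordinates of `z` are `x = z 0` and `t = z 1`. -/
abbrev Spacetime := EuclideanSpace ℝ (Fin 2)

/-- The unit vector in the direction of `x`. -/
abbrev eX : Spacetime := EuclideanSpace.single 0 1

/-- The unit vector in the direction of `t`. -/
abbrev eT : Spacetime := EuclideanSpace.single 1 1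

/-- The affine map `x ↦ (x, t)`. -/
def sliceMap (t : ℝ) (x : ℝ) : Spacetime := x • eX + t • eT

theorem sliceMap_hasTemperateGrowth (t : ℝ) : (sliceMap t).HasTemperateGrowth := by
  unfold sliceMap
  fun_prop

theorem norm_le_sliceMap (t x : ℝ) : ‖x‖ ≤ 1 * (1 + ‖sliceMap t x‖) ^ 1 := by
  have h := EuclideanSpace.norm_eq (sliceMap t x)
  have h1 : ‖x‖ ≤ ‖sliceMap t x‖ := by
    have := PiLp.norm_apply_le (sliceMap t x) 0
    simpa [sliceMap] using this
  linarith

/-- The restriction `x ↦ φ(x, t)` of a Schwartz function to a time slice. -/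
def slice (t : ℝ) : 𝓢(Spacetime, ℂ) →L[ℂ] 𝓢(ℝ, ℂ) :=
  SchwartzMap.compCLM ℂ (sliceMap_hasTemperateGrowth t) ⟨1, 1, norm_le_sliceMap t⟩

theorem slice_apply (t : ℝ) (φ : 𝓢(Spacetime, ℂ)) (x : ℝ) : slice t φ x = φ !₂[x, t] := by
  change φ (sliceMap t x) = _
  congr 1
  ext i
  fin_cases i <;> simp [sliceMap]

/-- The distribution `u` on space-time is the one given by the family `t ↦ U(t)` of distributions
on space: `⟨u, φ⟩ = ∫ ⟨U(t), φ(·, t)⟩ dt`. -/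
def HasTimeSlices (u : 𝓢'(Spacetime, ℂ)) (U : ℝ → 𝓢'(ℝ, ℂ)) : Prop :=
  ∀ φ : 𝓢(Spacetime, ℂ), Integrable (fun t ↦ U t (slice t φ)) ∧ u φ = ∫ t, U t (slice t φ)

/-- `u` is a distributional solution of `∂ₜ² u - ∂ₓ² u = σ u^p`. -/
def SolvesWaveEquation (σ : ℝ) (p : ℕ) (u : 𝓢'(Spacetime, ℂ)) : Prop :=
  ∃ w : 𝓢'(Spacetime, ℂ), IsPower u p w ∧
    ∂_{eT} (∂_{eT} u) - ∂_{eX} (∂_{eX} u) = (σ : ℂ) • w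

/-- The family `t ↦ A · U((e x + c t) / γ)`, where `γ = √|1 - c²|`, of distributions in `x`. -/
def boostedProfile (c e : ℝ) (A : ℂ) (U : 𝓢'(ℝ, ℂ)) (t : ℝ) : 𝓢'(ℝ, ℂ) :=
  A • affinePullback (e / √|1 - c ^ 2|) (c * t / √|1 - c ^ 2|) U

end AnomalousWave

end

/-! Put μ = 2/(p-1) = -λ. The distribution (x+i0)^(-μ) is, up to a nonzero constant, the inverse
Fourier transform of the Riesz measure r₊^(μ-1)/Γ(μ) dr (`cpow_add_mul_I`,
`tendsto_integral_mul_cpow`). The travelling wave u is K times the inverse Fourier transform of the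
same measure carried to the ray spanned by v = (α, β) = (e/γ, c/γ). Everything is read off from this
spectral picture.

Products. On a ray there is no cancellation: ‖y + z‖ = ‖y‖ + ‖z‖. So measures of temperate growth on
a common ray can be convolved, which gives the Fourier products (`IsOnRay.isFourierProduct`). The
wave front sets lie over the half-space ⟨ξ, v⟩ > 0, so Hörmander's criterion holds as well, and
Fubini shows that both products agree (`IsOnRay.isHormanderProduct`). Riesz measures form a
convolution semigroup (`rieszMeasure_conv`), so u^p is K^p times the wave of index pμ.

Equation. A derivative multiplies the spectrum by r, which raises the index by one
(`lineDerivOp_homogeneousWave`). Since pμ = μ + 2, both sides of the equation are multiples of one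
and the same wave, and what remains is σK^(p-1) = 4π²(α² - β²)μ(μ+1). This has a complex root,
nonzero because c ≠ ±1.

Singular support. Off the hyperplane ⟨z, v⟩ = 0 the wave is a multiple of the smooth function ⟨z,
v⟩^(-μ), which blows up at the hyperplane (`singularSupport_homogeneousWave`).

Regularity. The Fourier transform of a cut-off time slice is O((1+|ξ|)^(μ-1)) uniformly in time, and
(1+|ξ|)^(s+μ-1) is square integrable exactly for s < 1/2 - μ (`exists_norm_rayDensity_le`). Time
enters only through a phase of modulus one, so dominated convergence in L² gives continuity. A time
derivative costs a factor r, that is, one unit of the index and one Sobolev order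
(`hasDerivIntoHloc_of_ray`). -/

noncomputable section

namespace AnomalousWave

/-! ### The semigroup of Riesz measures on the half-line -/

/-- The density `r ↦ r₊^(a-1) / Γ(a)`. -/
def rieszDensity (a : ℝ) : ℝ → ℝ :=
  (Set.Ioi 0).indicator fun r ↦ r ^ (a - 1) / Real.Gamma a

/-- The measure `r₊^(a-1) / Γ(a) dr`. -/
def rieszMeasure (a : ℝ) : Measure ℝ :=
  volume.withDensity fun r ↦ ENNReal.ofReal (rieszDensity a r)

instance (a : ℝ) : SFinite (rieszMeasure a) := by unfold rieszMeasure; infer_instance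

theorem measurable_rieszDensity (a : ℝ) : Measurable (rieszDensity a) :=
  Measurable.indicator (by fun_prop) measurableSet_Ioi

theorem rieszDensity_of_pos {a r : ℝ} (hr : 0 < r) :
    rieszDensity a r = r ^ (a - 1) / Real.Gamma a :=
  Set.indicator_of_mem (Set.mem_Ioi.2 hr) _

theorem rieszDensity_of_nonpos {a r : ℝ} (hr : r ≤ 0) : rieszDensity a r = 0 :=
  Set.indicator_of_notMem (Set.notMem_Ioi.2 hr) _

theorem rieszDensity_nonneg {a : ℝ} (ha : 0 < a) (r : ℝ) : 0 ≤ rieszDensity a r := by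
  have := Real.Gamma_pos_of_pos ha
  exact Set.indicator_nonneg (fun r hr ↦ by have : 0 < r := hr; positivity) r

theorem integral_rpow_mul_sub_rpow {a b x : ℝ} (ha : 0 < a) (hb : 0 < b) (hx : 0 < x) :
    ∫ y in Set.Ioc 0 x, y ^ (a - 1) * (x - y) ^ (b - 1) =
      x ^ (a + b - 1) * (Real.Gamma a * Real.Gamma b / Real.Gamma (a + b)) := by
  have h := Complex.betaIntegral_scaled a b hx
  have hG := Complex.Gamma_mul_Gamma_eq_betaIntegral (s := a) (t := b) (by simpa) (by simpa)
  have hG0 : Real.Gamma (a + b) ≠ 0 := (Real.Gamma_pos_of_pos (by positivity)).ne'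
  have hB : Complex.betaIntegral a b =
      ((Real.Gamma a * Real.Gamma b / Real.Gamma (a + b) : ℝ) : ℂ) := by
    rw [← Complex.ofReal_add, Complex.Gamma_ofReal, Complex.Gamma_ofReal,
      Complex.Gamma_ofReal] at hG
    push_cast
    rw [hG, mul_div_cancel_left₀]
    exact_mod_cast hG0
  rw [intervalIntegral.integral_of_le hx.le, hB] at h
  apply Complex.ofReal_injective
  rw [← integral_complex_ofReal]
  push_cast at h ⊢
  rw [Complex.ofReal_cpow hx.le]
  push_cast
  rw [← h]
  refine setIntegral_congr_fun measurableSet_Ioc fun y hy ↦ ?_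
  rw [Complex.ofReal_cpow hy.1.le, Complex.ofReal_cpow (by linarith [hy.2])]
  push_cast
  rfl

/-- The Riesz measures form a convolution semigroup. -/
theorem rieszMeasure_conv {a b : ℝ} (ha : 0 < a) (hb : 0 < b) :
    Measure.conv (rieszMeasure a) (rieszMeasure b) = rieszMeasure (a + b) := by
  unfold rieszMeasure
  rw [conv_withDensity_eq_lconvolution (measurable_rieszDensity a).ennreal_ofReal
    (measurable_rieszDensity b).ennreal_ofReal]
  congr 1
  ext x
  rw [lconvolution_def]
  rcases le_or_gt x 0 with hx | hx
  · rw [rieszDensity_of_nonpos hx, ENNReal.ofReal_zero]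
    refine (lintegral_congr fun y ↦ ?_).trans lintegral_zero
    rcases le_or_gt y 0 with hy | hy
    · simp [rieszDensity_of_nonpos hy]
    · simp [rieszDensity_of_nonpos (a := b) (show -y + x ≤ 0 by linarith)]
  have hGa := Real.Gamma_pos_of_pos ha
  have hGb := Real.Gamma_pos_of_pos hb
  have hGab := Real.Gamma_pos_of_pos (add_pos ha hb)
  have key := integral_rpow_mul_sub_rpow ha hb hx
  -- The Bochner integral of a non-integrable function is 0, while `key` gives a positive value;
  -- this proves integrability.
  have hint : IntegrableOn (fun y ↦ y ^ (a - 1) * (x - y) ^ (b - 1)) (Set.Ioc 0 x) := by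
    by_contra h
    rw [integral_undef h] at key
    have : 0 < x ^ (a + b - 1) * (Real.Gamma a * Real.Gamma b / Real.Gamma (a + b)) := by
      positivity
    linarith
  have h1 : ∀ y, ENNReal.ofReal (rieszDensity a y) * ENNReal.ofReal (rieszDensity b (-y + x)) =
      (Set.Ioo 0 x).indicator (fun y ↦ ENNReal.ofReal
        (y ^ (a - 1) * (x - y) ^ (b - 1) / (Real.Gamma a * Real.Gamma b))) y := by
    intro y
    rw [← ENNReal.ofReal_mul (rieszDensity_nonneg ha y)]
    by_cases hy : y ∈ Set.Ioo 0 x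
    · rw [Set.indicator_of_mem hy, rieszDensity_of_pos hy.1,
        rieszDensity_of_pos (by linarith [hy.2]), div_mul_div_comm]
      ring_nf
    · rw [Set.indicator_of_notMem hy]
      by_cases h0 : 0 < y
      · have : x ≤ y := by
          by_contra h
          exact hy ⟨h0, not_le.1 h⟩
        simp [rieszDensity_of_nonpos (a := b) (show -y + x ≤ 0 by linarith)]
      · simp [rieszDensity_of_nonpos (not_lt.1 h0)]
  simp_rw [h1]
  rw [lintegral_indicator measurableSet_Ioo, restrict_Ioo_eq_restrict_Ioc,
    ← ofReal_integral_eq_lintegral_ofReal (hint.div_const _), integral_div, key,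
    rieszDensity_of_pos hx]
  · congr 1
    field_simp
  · filter_upwards [ae_restrict_mem measurableSet_Ioc] with y hy
    have h1 : 0 < y := hy.1
    have h2 : 0 ≤ x - y := by linarith [hy.2]
    show 0 ≤ _
    positivity

theorem ae_rieszMeasure_pos (a : ℝ) : ∀ᵐ r ∂(rieszMeasure a), 0 < r := by
  rw [rieszMeasure, ae_withDensity_iff (measurable_rieszDensity a).ennreal_ofReal]
  filter_upwards with r hr
  by_contra h
  exact hr (by simp [rieszDensity_of_nonpos (not_lt.1 h)])

section

variable {F : Type*} [NormedAddCommGroup F] [NormedSpace ℝ F]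

theorem integrable_rieszMeasure_iff {a : ℝ} (ha : 0 < a) {f : ℝ → F} :
    Integrable f (rieszMeasure a) ↔ Integrable fun r ↦ rieszDensity a r • f r := by
  rw [rieszMeasure, integrable_withDensity_iff_integrable_smul'
    (measurable_rieszDensity a).ennreal_ofReal (by simp)]
  simp only [ENNReal.toReal_ofReal (rieszDensity_nonneg ha _)]

theorem integral_rieszMeasure {a : ℝ} (ha : 0 < a) (f : ℝ → F) :
    ∫ r, f r ∂(rieszMeasure a) = ∫ r, rieszDensity a r • f r := by
  rw [rieszMeasure, integral_withDensity_eq_integral_toReal_smul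
    (measurable_rieszDensity a).ennreal_ofReal (by simp)]
  simp only [ENNReal.toReal_ofReal (rieszDensity_nonneg ha _)]

/-- This is Γ(a+1) = aΓ(a). Multiplication by r is what differentiation does to the spectrum, so
this is the source of every shift from a to a + 1. -/
theorem mul_rieszDensity {a : ℝ} (ha : 0 < a) (r : ℝ) :
    r * rieszDensity a r = a * rieszDensity (a + 1) r := by
  rcases le_or_gt r 0 with hr | hr
  · simp [rieszDensity_of_nonpos hr]
  · have := Real.Gamma_pos_of_pos ha
    have h : r ^ (a + 1 - 1) = r ^ (a - 1) * r := by
      rw [← Real.rpow_add_one hr.ne']; ring_nf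
    rw [rieszDensity_of_pos hr, rieszDensity_of_pos hr, Real.Gamma_add_one ha.ne', h]
    field_simp

theorem integral_smul_rieszMeasure {a : ℝ} (ha : 0 < a) (f : ℝ → F) :
    ∫ r, r • f r ∂(rieszMeasure a) = a • ∫ r, f r ∂(rieszMeasure (a + 1)) := by
  rw [integral_rieszMeasure ha, integral_rieszMeasure (by positivity), ← integral_smul]
  congr 1
  ext r
  rw [smul_smul, smul_smul, mul_comm, mul_rieszDensity ha]

end

/-- Near 0 the density is integrable because a > 0; at infinity a weight of order n > a suffices. -/
theorem rieszMeasure_hasTemperateGrowth {a : ℝ} (ha : 0 < a) :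
    (rieszMeasure a).HasTemperateGrowth := by
  obtain ⟨n, hn⟩ := exists_nat_gt a
  refine ⟨n, ?_⟩
  rw [integrable_rieszMeasure_iff ha]
  have hG := Real.Gamma_pos_of_pos ha
  have hsm : AEStronglyMeasurable (fun r ↦ rieszDensity a r • (1 + ‖r‖) ^ (-(n : ℝ))) :=
    ((measurable_rieszDensity a).smul (by fun_prop)).aestronglyMeasurable
  have h0 : IntegrableOn (fun r ↦ rieszDensity a r • (1 + ‖r‖) ^ (-(n : ℝ))) (Set.Ioc 0 1) := by
    have := (intervalIntegral.intervalIntegrable_rpow' (a := 0) (b := 1)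
      (show -1 < a - 1 by linarith)).1.div_const (Real.Gamma a)
    refine this.mono' hsm.restrict ?_
    filter_upwards [ae_restrict_mem measurableSet_Ioc] with r hr
    have hr0 : 0 < r := hr.1
    rw [norm_smul, Real.norm_of_nonneg (rieszDensity_nonneg ha r), rieszDensity_of_pos hr.1,
      Real.norm_of_nonneg (by positivity)]
    refine mul_le_of_le_one_right (by positivity) ?_
    exact Real.rpow_le_one_of_one_le_of_nonpos (by linarith [norm_nonneg r]) (by simp)
  have h1 : IntegrableOn (fun r ↦ rieszDensity a r • (1 + ‖r‖) ^ (-(n : ℝ))) (Set.Ioi 1) := by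
    have := (integrableOn_Ioi_rpow_of_lt (show a - 1 - n < -1 by linarith) zero_lt_one).div_const
      (Real.Gamma a)
    refine this.mono' hsm.restrict ?_
    filter_upwards [ae_restrict_mem measurableSet_Ioi] with r hr
    have hr0 : 0 < r := zero_lt_one.trans hr
    rw [norm_smul, Real.norm_of_nonneg (rieszDensity_nonneg ha r), rieszDensity_of_pos hr0,
      Real.norm_of_nonneg (by positivity), sub_eq_add_neg (a - 1), Real.rpow_add hr0,
      div_mul_eq_mul_div]
    refine div_le_div_of_nonneg_right (mul_le_mul_of_nonneg_left ?_ (by positivity)) hG.le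
    refine Real.rpow_le_rpow_of_nonpos hr0 ?_ (neg_nonpos.2 (Nat.cast_nonneg n))
    rw [Real.norm_of_nonneg hr0.le]
    linarith
  have h2 : IntegrableOn (fun r ↦ rieszDensity a r • (1 + ‖r‖) ^ (-(n : ℝ))) (Set.Iic 0) := by
    refine (integrableOn_zero).congr_fun (fun r hr ↦ ?_) measurableSet_Iic
    simp [rieszDensity_of_nonpos (Set.mem_Iic.1 hr)]
  have h3 := (h2.union h0).union h1
  rwa [Set.Iic_union_Ioc_eq_Iic zero_le_one, Set.Iic_union_Ioi, integrableOn_univ] at h3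

theorem integral_rpow_mul_exp_rieszMeasure {a t : ℝ} (ha : 0 < a) (ht : 0 < t) :
    ∫ r, Real.exp (-t * r) ∂(rieszMeasure a) = (1 / t) ^ a := by
  have hG := Real.Gamma_pos_of_pos ha
  have h : ∀ r, rieszDensity a r • Real.exp (-t * r) =
      (Set.Ioi 0).indicator (fun r ↦ r ^ (a - 1) * Real.exp (-(t * r)) / Real.Gamma a) r := by
    intro r
    by_cases hr : 0 < r
    · rw [Set.indicator_of_mem (Set.mem_Ioi.2 hr), rieszDensity_of_pos hr, smul_eq_mul, neg_mul]
      ring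
    · rw [Set.indicator_of_notMem (by simpa using hr), rieszDensity_of_nonpos (not_lt.1 hr),
        zero_smul]
  rw [integral_rieszMeasure ha]
  simp_rw [h]
  rw [integral_indicator measurableSet_Ioi, integral_div,
    Real.integral_rpow_mul_exp_neg_mul_Ioi ha ht, mul_div_cancel_right₀ _ hG.ne']

theorem integrable_exp_rieszMeasure {a t : ℝ} (ha : 0 < a) (ht : 0 < t) :
    Integrable (fun r ↦ Real.exp (-t * r)) (rieszMeasure a) := by
  by_contra h
  have h1 := integral_rpow_mul_exp_rieszMeasure ha ht
  rw [integral_undef h] at h1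
  have : 0 < (1 / t) ^ a := by positivity
  linarith

/-- The Laplace transform of the Riesz measure. -/
theorem integral_cexp_rieszMeasure {a : ℝ} (ha : 0 < a) {z : ℂ} (hz : 0 < z.re) :
    ∫ r : ℝ, Complex.exp (-z * r) ∂(rieszMeasure a) = z ^ (-a : ℂ) := by
  have hsub : {w : ℂ | w.re < 0} ⊆
      {w | w.re ∈ interior (ProbabilityTheory.integrableExpSet id (rieszMeasure a))} := by
    intro w hw
    refine mem_interior.2 ⟨Set.Iio 0, fun t ht ↦ ?_, isOpen_Iio, hw⟩
    have := integrable_exp_rieszMeasure ha (neg_pos.2 (Set.mem_Iio.1 ht))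
    simpa [ProbabilityTheory.integrableExpSet] using this
  have h1 : AnalyticOnNhd ℂ (ProbabilityTheory.complexMGF id (rieszMeasure a)) {w | w.re < 0} :=
    ProbabilityTheory.analyticOnNhd_complexMGF.mono hsub
  have ho : IsOpen {w : ℂ | w.re < 0} := isOpen_Iio.preimage Complex.continuous_re
  have h2 : AnalyticOnNhd ℂ (fun w : ℂ ↦ (-w) ^ (-a : ℂ)) {w | w.re < 0} := by
    refine DifferentiableOn.analyticOnNhd (fun w hw ↦ ?_) ho
    refine (DifferentiableAt.cpow (by fun_prop) (by fun_prop) ?_).differentiableWithinAt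
    exact Or.inl (by simpa using hw)
  -- Identity theorem on the left half-plane: both sides are analytic in w = -z and agree on the
  -- negative real axis, which accumulates at -1.
  have h3 := h1.eqOn_of_preconnected_of_frequently_eq h2 (z₀ := ((-1 : ℝ) : ℂ))
    ((convex_halfSpace_re_lt 0).isPreconnected) (by simp) ?_
  · have := h3 (x := -z) (by simpa using hz)
    simpa [ProbabilityTheory.complexMGF] using this
  · have hreal : ∀ᶠ t : ℝ in 𝓝[≠] (-1 : ℝ),
        ProbabilityTheory.complexMGF id (rieszMeasure a) (t : ℂ) = (-(t : ℂ)) ^ (-a : ℂ) := by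
      filter_upwards [nhdsWithin_le_nhds (Iio_mem_nhds (show (-1 : ℝ) < 0 by simp))] with t ht
      have ht' : 0 < -t := neg_pos.2 ht
      have h := integral_rpow_mul_exp_rieszMeasure ha ht'
      rw [ProbabilityTheory.complexMGF_ofReal, ProbabilityTheory.mgf,
        show (-(t : ℂ)) = ((-t : ℝ) : ℂ) by push_cast; rfl, ← Complex.ofReal_neg a,
        ← Complex.ofReal_cpow ht'.le, Real.rpow_neg ht'.le, ← Real.inv_rpow ht'.le, ← one_div, ← h]
      simp
    have htend : Tendsto (fun t : ℝ ↦ (t : ℂ)) (𝓝[≠] (-1 : ℝ)) (𝓝[≠] ((-1 : ℝ) : ℂ)) := by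
      refine tendsto_nhdsWithin_iff.2 ⟨(Complex.continuous_ofReal.tendsto _).mono_left
        nhdsWithin_le_nhds, ?_⟩
      filter_upwards [self_mem_nhdsWithin] with t ht
      have : t ≠ -1 := ht
      exact fun h ↦ this (Complex.ofReal_injective h)
    exact htend.frequently hreal.frequently

/-! ### Riesz measures on rays -/

section

variable {E : Type*} [NormedAddCommGroup E] [NormedSpace ℝ E] [MeasurableSpace E] [BorelSpace E]

/-- The image of the Riesz measure on the ray spanned by `v`. -/
def rayMeasure (a : ℝ) (v : E) : Measure E :=
  (rieszMeasure a).map fun r ↦ r • v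

instance (a : ℝ) (v : E) : SFinite (rayMeasure a v) := by unfold rayMeasure; infer_instance

/-- The measure `ν` is carried by the closed ray spanned by `v`. -/
def IsOnRay (ν : Measure E) (v : E) : Prop :=
  ∀ᵐ y ∂ν, ∃ r : ℝ, 0 ≤ r ∧ y = r • v

theorem measurableSet_ray (v : E) : MeasurableSet {y : E | ∃ r : ℝ, 0 ≤ r ∧ y = r • v} := by
  have : {y : E | ∃ r : ℝ, 0 ≤ r ∧ y = r • v} = (fun r : ℝ ↦ r • v) '' Set.Ici 0 := by
    ext y
    simp [eq_comm]
  rw [this]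
  by_cases hv : v = 0
  · subst hv
    rw [show (fun r : ℝ ↦ r • (0 : E)) = fun _ ↦ 0 by ext; simp]
    rw [Set.Nonempty.image_const ⟨0, by simp⟩]
    exact measurableSet_singleton 0
  · exact ((isClosedEmbedding_smul_left hv).isClosedMap _ isClosed_Ici).measurableSet

theorem rayMeasure_isOnRay (a : ℝ) (v : E) : IsOnRay (rayMeasure a v) v := by
  rw [IsOnRay, rayMeasure, ae_map_iff (by fun_prop) (measurableSet_ray v)]
  filter_upwards [ae_rieszMeasure_pos a] with r hr using ⟨r, hr.le, rfl⟩

theorem rayMeasure_conv [SecondCountableTopology E] {a b : ℝ} (ha : 0 < a) (hb : 0 < b) (v : E) :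
    Measure.conv (rayMeasure a v) (rayMeasure b v) = rayMeasure (a + b) v := by
  have := Measure.map_conv_continuousLinearMap (μ := rieszMeasure a) (ν := rieszMeasure b)
    (ContinuousLinearMap.toSpanSingleton ℝ v)
  rw [rieszMeasure_conv ha hb] at this
  exact this.symm

theorem measurableEmbedding_smul_left {v : E} (hv : v ≠ 0) :
    MeasurableEmbedding fun r : ℝ ↦ r • v :=
  (isClosedEmbedding_smul_left hv).measurableEmbedding

theorem integral_rayMeasure {F : Type*} [NormedAddCommGroup F] [NormedSpace ℝ F] (a : ℝ) {v : E}
    (hv : v ≠ 0) (f : E → F) :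
    ∫ y, f y ∂(rayMeasure a v) = ∫ r, f (r • v) ∂(rieszMeasure a) :=
  (measurableEmbedding_smul_left hv).integral_map f

theorem rayMeasure_hasTemperateGrowth {a : ℝ} (ha : 0 < a) {v : E} (hv : v ≠ 0) :
    (rayMeasure a v).HasTemperateGrowth := by
  obtain ⟨n, hn⟩ := (rieszMeasure_hasTemperateGrowth ha).exists_integrable
  refine ⟨n, ?_⟩
  rw [rayMeasure, (measurableEmbedding_smul_left hv).integrable_map_iff]
  have hv' : 0 < ‖v‖ := norm_pos_iff.2 hv
  refine (hn.const_mul ((max 1 ‖v‖⁻¹) ^ n)).mono'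
    (Measurable.aestronglyMeasurable (by unfold Function.comp; fun_prop)) ?_
  filter_upwards with r
  simp only [Function.comp, norm_smul, Real.rpow_neg (show 0 ≤ 1 + ‖r‖ by positivity),
    Real.rpow_natCast, Real.rpow_neg (show 0 ≤ 1 + ‖r‖ * ‖v‖ by positivity)]
  rw [Real.norm_of_nonneg (by positivity), ← div_eq_mul_inv, ← div_pow, ← inv_pow]
  gcongr
  rw [inv_eq_one_div, div_le_div_iff₀ (by positivity) (by positivity), one_mul, mul_add, mul_one]
  have h1 := le_max_left 1 ‖v‖⁻¹
  have h2 : 1 ≤ max 1 ‖v‖⁻¹ * ‖v‖ := by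
    calc 1 = ‖v‖⁻¹ * ‖v‖ := by field_simp
      _ ≤ _ := by gcongr; exact le_max_right _ _
  nlinarith [norm_nonneg r]

end

/-! ### Polynomial weights -/

section Weight

variable {E : Type*} [NormedAddCommGroup E]

/-- The weight `(1 + ‖y‖)^(-k)`. -/
def weight (k : ℕ) (y : E) : ℝ := ((1 + ‖y‖) ^ k)⁻¹

theorem weight_pos (k : ℕ) (y : E) : 0 < weight k y := by unfold weight; positivity

theorem weight_nonneg (k : ℕ) (y : E) : 0 ≤ weight k y := (weight_pos k y).le

theorem continuous_weight (k : ℕ) : Continuous (weight k : E → ℝ) := by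
  unfold weight
  exact Continuous.inv₀ (by fun_prop) fun y ↦ by positivity

theorem weight_add (k l : ℕ) (y : E) : weight (k + l) y = weight k y * weight l y := by
  simp only [weight, pow_add, mul_inv]

theorem weight_anti {k l : ℕ} (h : k ≤ l) (y : E) : weight l y ≤ weight k y := by
  unfold weight
  gcongr
  linarith [norm_nonneg y]

theorem weight_le_of_le {k : ℕ} {C : ℝ} {F : Type*} [NormedAddCommGroup F] {x : E}
    {y : F} (h : 1 + ‖y‖ ≤ C * (1 + ‖x‖)) : weight k x ≤ C ^ k * weight k y := by
  unfold weight
  rw [← div_eq_mul_inv, inv_eq_one_div, div_le_div_iff₀ (by positivity) (by positivity), one_mul,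
    ← mul_pow]
  gcongr

/-- Peetre's inequality: a translation costs at most a polynomial factor in the shift. -/
theorem weight_add_left_le (k : ℕ) (x y : E) :
    weight k (y + x) ≤ (1 + ‖x‖) ^ k * weight k y := by
  refine weight_le_of_le ?_
  have : ‖y‖ ≤ ‖y + x‖ + ‖x‖ := by simpa using norm_sub_le (y + x) x
  nlinarith [norm_nonneg x, norm_nonneg (y + x)]

theorem weight_sub_le (k : ℕ) (x y : E) :
    weight k (y - x) ≤ (1 + ‖x‖) ^ k * weight k y := by
  simpa [sub_eq_add_neg] using weight_add_left_le k (-x) y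

variable [MeasurableSpace E]

theorem exists_integrable_weight [BorelSpace E] (ν : Measure E) [ν.HasTemperateGrowth] :
    ∃ k, ∀ l, k ≤ l → Integrable (weight l) ν := by
  obtain ⟨k, hk⟩ := Measure.HasTemperateGrowth.exists_integrable (μ := ν)
  refine ⟨k, fun l hl ↦ hk.mono' ((continuous_weight l).measurable.aestronglyMeasurable) ?_⟩
  filter_upwards with y
  rw [Real.norm_of_nonneg (weight_nonneg l y), Real.rpow_neg (by positivity), Real.rpow_natCast]
  exact weight_anti hl y

theorem hasTemperateGrowth_of_integrable_weight {ν : Measure E} {k : ℕ}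
    (h : Integrable (weight k) ν) : ν.HasTemperateGrowth := by
  refine ⟨k, h.congr ?_⟩
  filter_upwards with y
  rw [Real.rpow_neg (by positivity), Real.rpow_natCast, weight]

end Weight

section

variable {E F : Type*} [NormedAddCommGroup E] [NormedSpace ℝ E] [NormedAddCommGroup F]
  [NormedSpace ℝ F]

theorem exists_norm_le_weight (f : 𝓢(E, F)) (k : ℕ) :
    ∃ C, 0 ≤ C ∧ ∀ x, ‖f x‖ ≤ C * weight k x := by
  refine ⟨2 ^ k * (Finset.Iic (k, 0)).sup (fun m ↦ SchwartzMap.seminorm ℝ m.1 m.2) f,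
    mul_nonneg (by positivity) (apply_nonneg _ _), fun x ↦ ?_⟩
  have := SchwartzMap.one_add_le_sup_seminorm_apply (𝕜 := ℝ) (m := (k, 0)) le_rfl le_rfl f x
  rw [norm_iteratedFDeriv_zero] at this
  rw [weight, ← div_eq_mul_inv, le_div_iff₀ (by positivity), mul_comm]
  exact this

end

/-! ### Integrals of translates of a Schwartz function -/

section Translate

variable {E : Type} [NormedAddCommGroup E] [NormedSpace ℝ E] [MeasurableSpace E]
  [BorelSpace E] (ν : Measure E) [ν.HasTemperateGrowth]
  {F : Type} [NormedAddCommGroup F] [NormedSpace ℝ F]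

theorem integrable_translate [SecondCountableTopology E] (f : 𝓢(E, F)) (x : E) :
    Integrable (fun y ↦ f (y + x)) ν := by
  obtain ⟨k, hk⟩ := exists_integrable_weight ν
  obtain ⟨C, hC, hf⟩ := exists_norm_le_weight f k
  refine ((hk k le_rfl).const_mul (C * (1 + ‖x‖) ^ k)).mono'
    (f.continuous.comp (by fun_prop)).aestronglyMeasurable ?_
  filter_upwards with y
  refine (hf _).trans ?_
  rw [mul_assoc]
  gcongr
  exact weight_add_left_le k x y

theorem norm_integral_translate_le (f : 𝓢(E, F)) :
    ∃ (k : ℕ) (C : ℝ), ∀ x, ‖∫ y, f (y + x) ∂ν‖ ≤ C * (1 + ‖x‖) ^ k := by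
  obtain ⟨k, hk⟩ := exists_integrable_weight ν
  obtain ⟨C, hC, hf⟩ := exists_norm_le_weight f k
  refine ⟨k, C * ∫ y, weight k y ∂ν, fun x ↦ ?_⟩
  calc ‖∫ y, f (y + x) ∂ν‖ ≤ ∫ y, C * (1 + ‖x‖) ^ k * weight k y ∂ν := by
        refine norm_integral_le_of_norm_le ((hk k le_rfl).const_mul _) ?_
        filter_upwards with y
        refine (hf _).trans ?_
        rw [mul_assoc]
        gcongr
        exact weight_add_left_le k x y
    _ = _ := by rw [integral_const_mul]; ring

theorem hasFDerivAt_integral_translate [SecondCountableTopology E] (f : 𝓢(E, F)) (x : E) :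
    HasFDerivAt (fun x ↦ ∫ y, f (y + x) ∂ν) (∫ y, fderivCLM ℝ E F f (y + x) ∂ν) x := by
  obtain ⟨k, hk⟩ := exists_integrable_weight ν
  obtain ⟨C, hC, hf⟩ := exists_norm_le_weight (fderivCLM ℝ E F f) k
  refine hasFDerivAt_integral_of_dominated_of_fderiv_le (𝕜 := ℝ)
    (F' := fun x y ↦ fderivCLM ℝ E F f (y + x))
    (bound := fun y ↦ C * (2 + ‖x‖) ^ k * weight k y) (Metric.ball_mem_nhds x one_pos)
    (Eventually.of_forall fun z ↦ (integrable_translate ν f z).aestronglyMeasurable)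
    (integrable_translate ν f x) (integrable_translate ν _ x).aestronglyMeasurable ?_
    ((hk k le_rfl).const_mul _) ?_
  · filter_upwards with y z hz
    refine (hf _).trans ?_
    rw [mul_assoc]
    have hz' : ‖z‖ ≤ ‖x‖ + 1 := by
      have := norm_sub_norm_le z x
      rw [Metric.mem_ball, dist_eq_norm] at hz
      linarith
    gcongr
    refine (weight_add_left_le k z y).trans ?_
    have := weight_nonneg k y
    refine mul_le_mul_of_nonneg_right (pow_le_pow_left₀ (by positivity) ?_ k) this
    linarith
  · filter_upwards with y z hz
    have h := (f.hasFDerivAt (y + z)).comp z ((hasFDerivAt_id z).const_add y)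
    rwa [ContinuousLinearMap.comp_id] at h

/-- The multiplier φ * S⁻ in the definition of the convolution has this form; multiplication of a
distribution by it is meaningful only once temperate growth is known. -/
theorem hasTemperateGrowth_integral_translate [SecondCountableTopology E] (f : 𝓢(E, F)) :
    (fun x ↦ ∫ y, f (y + x) ∂ν).HasTemperateGrowth := by
  have hfd : ∀ {G : Type} [NormedAddCommGroup G] [NormedSpace ℝ G] (g : 𝓢(E, G)),
      fderiv ℝ (fun x ↦ ∫ y, g (y + x) ∂ν) = fun x ↦ ∫ y, fderivCLM ℝ E G g (y + x) ∂ν :=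
    fun g ↦ funext fun x ↦ (hasFDerivAt_integral_translate ν g x).fderiv
  -- The induction runs over all target spaces at once, because the derivative takes values in a
  -- space of linear maps.
  have key : ∀ n : ℕ, ∀ {G : Type} [NormedAddCommGroup G] [NormedSpace ℝ G] (g : 𝓢(E, G)),
      ContDiff ℝ n (fun x ↦ ∫ y, g (y + x) ∂ν) ∧
      ∃ (k : ℕ) (C : ℝ), ∀ x,
        ‖iteratedFDeriv ℝ n (fun x ↦ ∫ y, g (y + x) ∂ν) x‖ ≤ C * (1 + ‖x‖) ^ k := by
    intro n
    induction n with
    | zero =>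
      intro G _ _ g
      refine ⟨contDiff_zero.2 (continuous_iff_continuousAt.2 fun x ↦
        (hasFDerivAt_integral_translate ν g x).continuousAt), ?_⟩
      simpa only [norm_iteratedFDeriv_zero] using norm_integral_translate_le ν g
    | succ n ih =>
      intro G _ _ g
      obtain ⟨h1, k, C, h2⟩ := ih (fderivCLM ℝ E G g)
      rw [← hfd g] at h1 h2
      refine ⟨?_, k, C, fun x ↦ by rw [← norm_iteratedFDeriv_fderiv]; exact h2 x⟩
      push_cast
      exact contDiff_succ_iff_fderiv.2
        ⟨fun x ↦ (hasFDerivAt_integral_translate ν g x).differentiableAt, by simp, h1⟩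
  exact ⟨contDiff_infty.2 fun n ↦ (key n f).1, fun n ↦ (key n f).2⟩

end Translate

/-! ### Superpositions of plane waves -/

section Superposition

variable {E : Type} [NormedAddCommGroup E] [InnerProductSpace ℝ E] [FiniteDimensional ℝ E]
  [MeasurableSpace E] [BorelSpace E]

open Classical in
/-- The inverse Fourier transform of the measure `ν` of temperate growth (and `0` for a measure
that is not of temperate growth). -/
def superposition (ν : Measure E) : 𝓢'(E, ℂ) :=
  if _ : ν.HasTemperateGrowth then 𝓕⁻ ν.toTemperedDistribution else 0

theorem superposition_eq (ν : Measure E) [h : ν.HasTemperateGrowth] :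
    superposition ν = 𝓕⁻ ν.toTemperedDistribution :=
  dif_pos h

theorem superposition_apply (ν : Measure E) [ν.HasTemperateGrowth] (φ : 𝓢(E, ℂ)) :
    superposition ν φ = ∫ y, 𝓕⁻ φ y ∂ν := by
  rw [superposition_eq, TemperedDistribution.fourierInv_apply]
  rfl

theorem fourier_smul_superposition_apply (ν : Measure E) [ν.HasTemperateGrowth] (α : ℂ)
    (φ : 𝓢(E, ℂ)) : 𝓕 (α • superposition ν) φ = α * ∫ y, φ y ∂ν := by
  rw [superposition_eq, FourierTransform.fourier_smul, FourierTransform.fourier_fourierInv_eq]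
  rfl

theorem convReflect_fourier_superposition (ν : Measure E) [ν.HasTemperateGrowth] (α : ℂ)
    (φ : 𝓢(E, ℂ)) :
    convReflect φ (𝓕 (α • superposition ν)) = fun x ↦ α * ∫ y, φ (y + x) ∂ν := by
  ext x
  simp only [convReflect, fourier_smul_superposition_apply, compSubConstCLM_apply, sub_neg_eq_add]

/-- The absence of cancellation on a ray, on which all products rest. -/
theorem norm_add_of_mem_ray {E : Type*} [NormedAddCommGroup E] [NormedSpace ℝ E] {v x y : E}
    (hx : ∃ r : ℝ, 0 ≤ r ∧ x = r • v)
    (hy : ∃ r : ℝ, 0 ≤ r ∧ y = r • v) : ‖x + y‖ = ‖x‖ + ‖y‖ := by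
  obtain ⟨r, hr, rfl⟩ := hx
  obtain ⟨s, hs, rfl⟩ := hy
  rw [← add_smul, norm_smul, norm_smul, norm_smul, Real.norm_of_nonneg hr, Real.norm_of_nonneg hs,
    Real.norm_of_nonneg (add_nonneg hr hs), add_mul]

variable {ν₁ ν₂ : Measure E} {v : E}

theorem IsOnRay.ae_prod {E : Type*} [NormedAddCommGroup E] [NormedSpace ℝ E] [MeasurableSpace E]
    {ν₁ ν₂ : Measure E} {v : E} (h₁ : IsOnRay ν₁ v) (h₂ : IsOnRay ν₂ v) :
    ∀ᵐ p ∂(ν₁.prod ν₂), ‖p.1 + p.2‖ = ‖p.1‖ + ‖p.2‖ := by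
  filter_upwards [Measure.quasiMeasurePreserving_fst.ae h₁,
    Measure.quasiMeasurePreserving_snd.ae h₂] with p hp1 hp2
  exact norm_add_of_mem_ray hp1 hp2

/-- Since ‖y + z‖ dominates both ‖y‖ and ‖z‖ almost everywhere, a weight of order k + l in y + z is
bounded by the product of an integrable weight in y and one in z. -/
theorem IsOnRay.exists_integrable_weight_add [ν₁.HasTemperateGrowth] [ν₂.HasTemperateGrowth]
    (h₁ : IsOnRay ν₁ v) (h₂ : IsOnRay ν₂ v) :
    ∃ k, Integrable (fun p : E × E ↦ weight k (p.1 + p.2)) (ν₁.prod ν₂) := by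
  obtain ⟨k, hk⟩ := exists_integrable_weight ν₁
  obtain ⟨l, hl⟩ := exists_integrable_weight ν₂
  refine ⟨k + l, ((hk k le_rfl).mul_prod (hl l le_rfl)).mono'
    ((continuous_weight _).comp (by fun_prop)).aestronglyMeasurable ?_⟩
  filter_upwards [h₁.ae_prod h₂] with p hp
  rw [Real.norm_of_nonneg (weight_nonneg _ _), weight_add]
  have := norm_nonneg p.1
  have := norm_nonneg p.2
  refine mul_le_mul ?_ ?_ (weight_nonneg _ _) (weight_nonneg _ _) <;>
  · unfold weight
    rw [hp]
    gcongr
    linarith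

theorem IsOnRay.hasTemperateGrowth_conv [ν₁.HasTemperateGrowth] [ν₂.HasTemperateGrowth]
    (h₁ : IsOnRay ν₁ v) (h₂ : IsOnRay ν₂ v) : (Measure.conv ν₁ ν₂).HasTemperateGrowth := by
  obtain ⟨k, hk⟩ := h₁.exists_integrable_weight_add h₂
  refine hasTemperateGrowth_of_integrable_weight (k := k) ?_
  rw [Measure.conv, integrable_map_measure (continuous_weight k).aestronglyMeasurable
    (by fun_prop)]
  exact hk

variable [SFinite ν₁] [SFinite ν₂]

/-- Paired with χ, the distribution (φ * S⁻)T is αβ∬ φ(y + z) χ(z) against the product measure. The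
integrand is at most sup |χ| times an integrable weight in y + z, so the seminorm of order 0
suffices for 𝒟'_{L¹}, and dominated convergence along an approximate unit gives the total mass. -/
theorem IsOnRay.isFourierProduct [ν₁.HasTemperateGrowth] [ν₂.HasTemperateGrowth]
    [(Measure.conv ν₁ ν₂).HasTemperateGrowth] (h₁ : IsOnRay ν₁ v) (h₂ : IsOnRay ν₂ v) (α β : ℂ) :
    IsFourierProduct (α • superposition ν₁) (β • superposition ν₂)
      ((α * β) • superposition (Measure.conv ν₁ ν₂)) := by
  intro φ
  obtain ⟨k, hk⟩ := h₁.exists_integrable_weight_add h₂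
  obtain ⟨C, hC, hφ⟩ := exists_norm_le_weight φ k
  have htg : (fun x ↦ α * ∫ y, φ (y + x) ∂ν₁).HasTemperateGrowth := by
    have := hasTemperateGrowth_integral_translate ν₁ φ
    fun_prop
  have hint : ∀ χ : 𝓢(E, ℂ), Integrable (fun p : E × E ↦ φ (p.1 + p.2) * χ p.2) (ν₁.prod ν₂) := by
    intro χ
    refine (hk.const_mul (C * SchwartzMap.seminorm ℂ 0 0 χ)).mono' (by fun_prop) ?_
    filter_upwards with p
    rw [norm_mul, mul_right_comm]
    exact mul_le_mul (hφ _) (norm_le_seminorm ℂ χ _) (norm_nonneg _)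
      (mul_nonneg hC (weight_nonneg _ _))
  have happ : ∀ χ : 𝓢(E, ℂ),
      smulLeftCLM ℂ (convReflect φ (𝓕 (α • superposition ν₁))) (𝓕 (β • superposition ν₂)) χ =
        α * β * ∫ p, φ (p.1 + p.2) * χ p.2 ∂(ν₁.prod ν₂) := by
    intro χ
    rw [convReflect_fourier_superposition, TemperedDistribution.smulLeftCLM_apply_apply,
      fourier_smul_superposition_apply, integral_prod_symm _ (hint χ), mul_comm α β, mul_assoc,
      ← integral_const_mul α]
    congr 2
    ext z
    rw [SchwartzMap.smulLeftCLM_apply_apply htg, smul_eq_mul, mul_assoc]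
    exact congrArg _ (integral_mul_const _ _).symm
  constructor
  · refine ⟨0, ‖α * β‖ * ∫ p, C * weight k (p.1 + p.2) ∂(ν₁.prod ν₂), fun χ ↦ ?_⟩
    rw [happ, norm_mul, Finset.range_one, Finset.sum_singleton, mul_assoc]
    gcongr
    rw [← integral_mul_const]
    refine norm_integral_le_of_norm_le ((hk.const_mul C).mul_const _) ?_
    filter_upwards with p
    rw [norm_mul]
    exact mul_le_mul (hφ _) (norm_le_seminorm ℂ χ _) (norm_nonneg _)
      (mul_nonneg hC (weight_nonneg _ _))
  · intro χ ⟨hb, hχ⟩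
    obtain ⟨M, hM⟩ := hb 0
    simp_rw [happ]
    have hval : 𝓕 ((α * β) • superposition (Measure.conv ν₁ ν₂)) φ =
        α * β * ∫ p : E × E, φ (p.1 + p.2) ∂(ν₁.prod ν₂) := by
      rw [fourier_smul_superposition_apply, Measure.conv,
        integral_map (by fun_prop) φ.continuous.aestronglyMeasurable]
    rw [hval]
    refine Tendsto.const_mul _ ?_
    refine tendsto_integral_of_dominated_convergence (fun p ↦ C * weight k (p.1 + p.2) * M)
      (fun n ↦ (hint (χ n)).aestronglyMeasurable) ((hk.const_mul C).mul_const M) ?_ ?_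
    · intro n
      filter_upwards with p
      rw [norm_mul]
      exact mul_le_mul (hφ _) ((norm_le_seminorm ℂ (χ n) _).trans (hM n)) (norm_nonneg _)
        (mul_nonneg hC (weight_nonneg _ _))
    · filter_upwards with p
      refine tendsto_const_nhds.congr' ?_
      filter_upwards [hχ {p.2} isCompact_singleton] with n hn
      rw [hn p.2 rfl, mul_one]

end Superposition

/-! ### Wave front sets and local products of superpositions of plane waves -/

theorem iteratedDeriv_cexp_const_mul_ofReal (n : ℕ) (c : ℂ) :
    iteratedDeriv n (fun t : ℝ ↦ Complex.exp (c * t)) =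
      fun t : ℝ ↦ c ^ n * Complex.exp (c * t) := by
  induction n with
  | zero => simp
  | succ n ih =>
    rw [iteratedDeriv_succ, ih]
    ext t
    have h : HasDerivAt (fun t : ℝ ↦ Complex.exp (c * t)) (Complex.exp (c * t) * c) t := by
      have := ((Complex.ofRealCLM.hasDerivAt (x := t)).const_mul c).cexp
      simpa using this
    rw [(h.const_mul _).deriv]
    ring

theorem hasTemperateGrowth_cexp {c : ℂ} (hc : c.re = 0) :
    (fun t : ℝ ↦ Complex.exp (c * t)).HasTemperateGrowth := by
  refine ⟨Complex.contDiff_exp.comp (contDiff_const.mul Complex.ofRealCLM.contDiff),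
    fun n ↦ ⟨0, ‖c‖ ^ n, fun t ↦ ?_⟩⟩
  rw [norm_iteratedFDeriv_eq_norm_iteratedDeriv, iteratedDeriv_cexp_const_mul_ofReal]
  simp [Complex.norm_exp, hc]

section

variable {E : Type} [NormedAddCommGroup E] [InnerProductSpace ℝ E]

theorem hasTemperateGrowth_cexp_inner {c : ℂ} (hc : c.re = 0) (ξ : E) :
    (fun x : E ↦ Complex.exp (c * (inner ℝ x ξ : ℝ))).HasTemperateGrowth :=
  (hasTemperateGrowth_cexp hc).comp (Function.hasTemperateGrowth_inner_left ξ)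

theorem exists_cutoff [FiniteDimensional ℝ E] (x : E) :
    ∃ χ : 𝓢(E, ℂ), HasCompactSupport χ ∧ ∀ᶠ y in 𝓝 x, χ y = 1 := by
  let b : ContDiffBump x := ⟨1, 2, one_pos, one_lt_two⟩
  have h1 : HasCompactSupport (fun y ↦ (b y : ℂ)) :=
    b.hasCompactSupport.comp_left (g := ((↑) : ℝ → ℂ)) rfl
  have h2 : ContDiff ℝ ∞ (fun y ↦ (b y : ℂ)) := Complex.ofRealCLM.contDiff.comp b.contDiff
  refine ⟨h1.toSchwartzMap h2, h1, ?_⟩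
  filter_upwards [b.eventuallyEq_one] with y hy
  change (b y : ℂ) = 1
  rw [hy]
  simp

variable [FiniteDimensional ℝ E] [MeasurableSpace E] [BorelSpace E]

theorem fourierInv_apply (f : 𝓢(E, ℂ)) (y : E) :
    𝓕⁻ f y = ∫ x, Complex.exp (2 * Real.pi * Complex.I * (inner ℝ x y : ℝ)) * f x := by
  rw [SchwartzMap.fourierInv_coe, Real.fourierInv_eq']
  congr 1
  ext x
  rw [smul_eq_mul]
  congr 2
  push_cast
  ring

/-- Modulating the cut-off translates its inverse Fourier transform. -/
theorem localFourier_superposition (ν : Measure E) [ν.HasTemperateGrowth] (α : ℂ) (χ : 𝓢(E, ℂ))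
    (ξ : E) : localFourier (α • superposition ν) χ ξ = α * ∫ y, 𝓕⁻ χ (y - ξ) ∂ν := by
  change α * superposition ν _ = _
  rw [superposition_apply]
  congr 2
  ext y
  rw [fourierInv_apply, fourierInv_apply]
  congr 1
  ext x
  rw [SchwartzMap.smulLeftCLM_apply_apply (hasTemperateGrowth_cexp_inner (by simp) ξ), smul_eq_mul,
    ← mul_assoc, ← Complex.exp_add, inner_sub_right]
  congr 2
  push_cast
  ring

/-- The inverse Fourier transform of a product is the convolution. -/
theorem fourierInv_smulLeft (f g : 𝓢(E, ℂ)) (x : E) :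
    𝓕⁻ (SchwartzMap.smulLeftCLM ℂ f g) x = ∫ t, 𝓕⁻ f t * 𝓕⁻ g (x - t) := by
  have h : SchwartzMap.smulLeftCLM ℂ f g =
      𝓕 (SchwartzMap.convolution (ContinuousLinearMap.mul ℂ ℂ) (𝓕⁻ f) (𝓕⁻ g)) := by
    rw [SchwartzMap.fourier_convolution, FourierTransform.fourier_fourierInv_eq,
      FourierTransform.fourier_fourierInv_eq]
    ext y
    rw [SchwartzMap.smulLeftCLM_apply_apply f.hasTemperateGrowth, pairing_apply_apply]
    rfl
  rw [h, FourierTransform.fourierInv_fourier_eq, SchwartzMap.convolution_apply]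
  rfl

/-- If ⟨ξ, v⟩ ≤ 0, then ξ has a conic neighbourhood making an angle of more than 60° with the ray.
For η in it and y on the ray, ‖y - η‖ controls both ‖y‖ and ‖η‖, so the rapid decay of `𝓕⁻ χ` gives
rapid decay of the localized Fourier transform. -/
theorem IsOnRay.inner_pos_of_mem_waveFrontSet {ν : Measure E} [ν.HasTemperateGrowth] {v : E}
    (hν : IsOnRay ν v) {α : ℂ} {x ξ : E} (h : (x, ξ) ∈ waveFrontSet (α • superposition ν)) :
    0 < inner ℝ ξ v := by
  by_contra hneg
  rw [not_lt] at hneg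
  obtain ⟨hξ, h⟩ := h
  -- For v = 0 the cone used below would be empty; here the measure sits at the origin, and every
  -- direction is of rapid decay.
  rcases eq_or_ne v 0 with rfl | hv
  · refine h ?_
    obtain ⟨χ, hχ, h1⟩ := exists_cutoff x
    have hν0 : ∀ᵐ y ∂ν, y = 0 := by
      filter_upwards [hν] with y hy
      obtain ⟨r, -, rfl⟩ := hy
      simp
    refine ⟨χ, hχ, by rw [h1.self_of_nhds]; exact one_ne_zero, Set.univ, isOpen_univ, trivial,
      fun _ _ _ _ ↦ trivial, fun N ↦ ?_⟩
    obtain ⟨C, hC, hf⟩ := exists_norm_le_weight (𝓕⁻ χ) N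
    refine ⟨‖α‖ * (ν.real Set.univ * C), fun η _ ↦ ?_⟩
    have : ∫ y, 𝓕⁻ χ (y - η) ∂ν = ∫ y, 𝓕⁻ χ (0 - η) ∂ν := by
      refine integral_congr_ae ?_
      filter_upwards [hν0] with y hy
      rw [hy]
    rw [localFourier_superposition, this, integral_const, norm_mul, norm_smul, mul_assoc,
      Real.norm_of_nonneg measureReal_nonneg, mul_assoc]
    gcongr
    have := hf (0 - η)
    rw [weight, ← div_eq_mul_inv, le_div_iff₀ (by positivity)] at this
    simpa using this
  have hv' : 0 < ‖v‖ := norm_pos_iff.2 hv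
  obtain ⟨χ, hχ, h1⟩ := exists_cutoff x
  refine h ⟨χ, hχ, by rw [h1.self_of_nhds]; exact one_ne_zero,
    {η | inner ℝ η v < 1 / 2 * (‖η‖ * ‖v‖)}, ?_, ?_, ?_, fun N ↦ ?_⟩
  · exact isOpen_lt (by fun_prop) (by fun_prop)
  · have : 0 < ‖ξ‖ := norm_pos_iff.2 hξ
    exact hneg.trans_lt (by positivity)
  · intro r hr η hη
    rw [Set.mem_ofPred_eq] at hη ⊢
    rw [real_inner_smul_left, norm_smul, Real.norm_of_nonneg hr.le]
    nlinarith
  obtain ⟨k, hk⟩ := exists_integrable_weight ν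
  -- N orders of decay are spent on η, the other k on integrability against ν.
  obtain ⟨C, hC, hf⟩ := exists_norm_le_weight (𝓕⁻ χ) (N + k)
  refine ⟨‖α‖ * (C * 2 ^ N * 2 ^ k * ∫ y, weight k y ∂ν), fun η hη ↦ ?_⟩
  rw [localFourier_superposition, norm_mul, mul_assoc]
  refine mul_le_mul_of_nonneg_left ?_ (norm_nonneg α)
  rw [← le_div_iff₀ (by positivity), div_eq_mul_inv, mul_right_comm, ← integral_const_mul]
  refine norm_integral_le_of_norm_le ((hk k le_rfl).const_mul _) ?_
  filter_upwards [hν] with y hy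
  -- In the cone 2⟨y, η⟩ ≤ ‖y‖‖η‖ ≤ (‖y‖² + ‖η‖²)/2; insert this in the expansion of ‖y - η‖².
  have hsq : ‖η‖ ^ 2 + ‖y‖ ^ 2 ≤ 2 * ‖y - η‖ ^ 2 := by
    obtain ⟨r, hr, rfl⟩ := hy
    have h3 := norm_sub_sq_real (r • v) η
    rw [real_inner_smul_left, real_inner_comm] at h3
    rw [Set.mem_ofPred_eq] at hη
    have h4 : r * inner ℝ η v ≤ 1 / 2 * (‖η‖ * ‖r • v‖) := by
      rw [norm_smul, Real.norm_of_nonneg hr]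
      nlinarith
    nlinarith [sq_nonneg (‖η‖ - ‖r • v‖)]
  have e1 : ‖η‖ ≤ 2 * ‖y - η‖ := by
    refine le_of_sq_le_sq ?_ (by positivity)
    nlinarith [sq_nonneg ‖y‖, sq_nonneg ‖y - η‖]
  have e2 : ‖y‖ ≤ 2 * ‖y - η‖ := by
    refine le_of_sq_le_sq ?_ (by positivity)
    nlinarith [sq_nonneg ‖η‖, sq_nonneg ‖y - η‖]
  calc ‖𝓕⁻ χ (y - η)‖ ≤ C * weight (N + k) (y - η) := hf _
    _ ≤ C * ((2 ^ N * weight N η) * (2 ^ k * weight k y)) := by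
      rw [weight_add]
      have := weight_nonneg N (y - η)
      have := weight_nonneg k (y - η)
      have := weight_nonneg N η
      gcongr
      · exact weight_le_of_le (by linarith)
      · exact weight_le_of_le (by linarith)
    _ = _ := by rw [weight]; ring

theorem IsOnRay.hormanderCriterion {ν₁ ν₂ : Measure E} [ν₁.HasTemperateGrowth]
    [ν₂.HasTemperateGrowth] {v : E} (h₁ : IsOnRay ν₁ v) (h₂ : IsOnRay ν₂ v) (α β : ℂ) :
    HormanderCriterion (α • superposition ν₁) (β • superposition ν₂) := by
  intro x ξ _ hx hx'
  have a1 := h₁.inner_pos_of_mem_waveFrontSet hx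
  have a2 := h₂.inner_pos_of_mem_waveFrontSet hx'
  rw [inner_neg_left] at a2
  linarith

/-- As y + z = (y - η) + (z - (ξ - η)) + ξ, the decay of the two factors turns into decay in y + z,
which is integrable on a ray. The d extra orders in y - η make the integral over η converge. -/
theorem IsOnRay.integrable_prod_fourierInv {ν₁ ν₂ : Measure E} [SFinite ν₁] [SFinite ν₂]
    [ν₁.HasTemperateGrowth] [ν₂.HasTemperateGrowth] {v : E} (h₁ : IsOnRay ν₁ v)
    (h₂ : IsOnRay ν₂ v) (f : 𝓢(E, ℂ)) (ξ : E) :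
    Integrable (fun q : E × (E × E) ↦ f (q.2.1 - q.1) * f (q.2.2 - (ξ - q.1)))
      ((volume : Measure E).prod (ν₁.prod ν₂)) := by
  obtain ⟨k, hk⟩ := h₁.exists_integrable_weight_add h₂
  obtain ⟨d, hd⟩ := exists_integrable_weight (volume : Measure E)
  obtain ⟨C, hC, hf⟩ := exists_norm_le_weight f (k + d)
  have hdom : Integrable (fun q : E × (E × E) ↦ weight k (q.2.1 + q.2.2) * weight d (q.2.1 - q.1))
      ((volume : Measure E).prod (ν₁.prod ν₂)) := by
    have hcont : Continuous fun q : E × (E × E) ↦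
        weight k (q.2.1 + q.2.2) * weight d (q.2.1 - q.1) := by
      have := continuous_weight (E := E) k
      have := continuous_weight (E := E) d
      fun_prop
    rw [integrable_prod_iff' hcont.aestronglyMeasurable]
    refine ⟨Eventually.of_forall fun p ↦ ((hd d le_rfl).comp_sub_left p.1).const_mul
      (weight k (p.1 + p.2)), ?_⟩
    simp_rw [norm_mul, Real.norm_of_nonneg (weight_nonneg _ _), integral_const_mul,
      integral_sub_left_eq_self (weight d : E → ℝ)]
    exact hk.mul_const _
  refine (hdom.const_mul (C * C * (1 + ‖ξ‖) ^ k)).mono'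
    (Continuous.aestronglyMeasurable (by fun_prop)) (Eventually.of_forall fun q ↦ ?_)
  obtain ⟨η, y, z⟩ := q
  have key : weight k (y - η) * weight k (z - (ξ - η)) ≤ (1 + ‖ξ‖) ^ k * weight k (y + z) := by
    unfold weight
    rw [← mul_inv, ← mul_pow, ← div_eq_mul_inv, inv_eq_one_div,
      div_le_div_iff₀ (by positivity) (by positivity), one_mul, ← mul_pow]
    gcongr
    have h3 : ‖y + z‖ ≤ ‖y - η‖ + ‖z - (ξ - η)‖ + ‖ξ‖ := by
      have : y + z = (y - η) + (z - (ξ - η)) + ξ := by abel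
      rw [this]
      exact norm_add₃_le
    have := norm_nonneg (y - η)
    have := norm_nonneg (z - (ξ - η))
    have := norm_nonneg ξ
    nlinarith [mul_nonneg (norm_nonneg (y - η)) (norm_nonneg (z - (ξ - η))),
      mul_nonneg (norm_nonneg ξ) (mul_nonneg (norm_nonneg (y - η)) (norm_nonneg (z - (ξ - η)))),
      mul_nonneg (norm_nonneg ξ) (norm_nonneg (y - η)),
      mul_nonneg (norm_nonneg ξ) (norm_nonneg (z - (ξ - η)))]
  have hw1 : weight (k + d) (z - (ξ - η)) ≤ weight k (z - (ξ - η)) := weight_anti (by omega) _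
  have n1 := weight_nonneg k (y - η)
  have n2 := weight_nonneg d (y - η)
  have n3 := weight_nonneg k (z - (ξ - η))
  have n4 := weight_nonneg (k + d) (z - (ξ - η))
  calc ‖f (y - η) * f (z - (ξ - η))‖
      ≤ (C * weight (k + d) (y - η)) * (C * weight (k + d) (z - (ξ - η))) := by
        rw [norm_mul]
        exact mul_le_mul (hf _) (hf _) (norm_nonneg _) (mul_nonneg hC (weight_nonneg _ _))
    _ ≤ (C * (weight k (y - η) * weight d (y - η))) * (C * weight k (z - (ξ - η))) := by
        rw [weight_add k d (y - η)]
        gcongr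
    _ = C * C * (weight k (y - η) * weight k (z - (ξ - η))) * weight d (y - η) := by ring
    _ ≤ C * C * ((1 + ‖ξ‖) ^ k * weight k (y + z)) * weight d (y - η) := by gcongr
    _ = _ := by ring

/-- After Fubini the claim is, for fixed y and z, that the inverse Fourier transform of χ² is the
convolution of that of χ with itself, evaluated at y + z - ξ. -/
theorem IsOnRay.isHormanderProduct {ν₁ ν₂ : Measure E} [SFinite ν₁] [SFinite ν₂]
    [ν₁.HasTemperateGrowth] [ν₂.HasTemperateGrowth] [(Measure.conv ν₁ ν₂).HasTemperateGrowth]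
    {v : E} (h₁ : IsOnRay ν₁ v) (h₂ : IsOnRay ν₂ v) (α β : ℂ) :
    IsHormanderProduct (α • superposition ν₁) (β • superposition ν₂)
      ((α * β) • superposition (Measure.conv ν₁ ν₂)) := by
  refine ⟨h₁.hormanderCriterion h₂ α β, fun x ↦ ?_⟩
  obtain ⟨χ, hχ, h1⟩ := exists_cutoff x
  refine ⟨χ, hχ, h1, fun ξ ↦ ?_⟩
  have hint := h₁.integrable_prod_fourierInv h₂ (𝓕⁻ χ) ξ
  have heq : ∀ η, localFourier (α • superposition ν₁) χ η *
      localFourier (β • superposition ν₂) χ (ξ - η) =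
      α * β * ∫ p, 𝓕⁻ χ (p.1 - η) * 𝓕⁻ χ (p.2 - (ξ - η)) ∂(ν₁.prod ν₂) := by
    intro η
    rw [localFourier_superposition, localFourier_superposition,
      integral_prod_mul (fun y ↦ 𝓕⁻ χ (y - η)) (fun z ↦ 𝓕⁻ χ (z - (ξ - η)))]
    ring
  simp_rw [heq]
  refine ⟨hint.integral_prod_left.const_mul _, ?_⟩
  rw [localFourier_superposition, integral_const_mul,
    integral_integral_swap (f := fun η (p : E × E) ↦ 𝓕⁻ χ (p.1 - η) * 𝓕⁻ χ (p.2 - (ξ - η))) hint,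
    Measure.conv, integral_map (by fun_prop) (by fun_prop)]
  congr 2
  ext p
  rw [fourierInv_smulLeft, ← integral_sub_left_eq_self _ volume p.1]
  congr 1
  ext η
  congr 2
  abel

end

/-! ### Plane waves with homogeneous profile -/

section

variable {E : Type} [NormedAddCommGroup E] [InnerProductSpace ℝ E] [FiniteDimensional ℝ E]
  [MeasurableSpace E] [BorelSpace E]

/-- The distribution `∫ e^{2πi r ⟨x, v⟩} r₊^(a-1) / Γ(a) dr`, a multiple of
`(⟨x, v⟩ + i0)^(-a)`. -/
def homogeneousWave (a : ℝ) (v : E) : 𝓢'(E, ℂ) :=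
  superposition (rayMeasure a v)

variable {a : ℝ} {v : E}

theorem homogeneousWave_apply (ha : 0 < a) (hv : v ≠ 0) (φ : 𝓢(E, ℂ)) :
    homogeneousWave a v φ = ∫ r, 𝓕⁻ φ (r • v) ∂(rieszMeasure a) := by
  have := rayMeasure_hasTemperateGrowth ha hv
  rw [homogeneousWave, superposition_apply, integral_rayMeasure a hv]

/-- Each further factor convolves with one more Riesz measure on the same ray, so indices add. -/
theorem isPower_homogeneousWave (ha : 0 < a) (hv : v ≠ 0) (α : ℂ) (k : ℕ) :
    IsPower (α • homogeneousWave a v) (k + 1)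
      (α ^ (k + 1) • homogeneousWave ((k + 1 : ℕ) * a) v) := by
  induction k with
  | zero => simpa using IsPower.one
  | succ k ih =>
    have hk : 0 < (k + 1 : ℕ) * a := by positivity
    have h1 := rayMeasure_isOnRay ((k + 1 : ℕ) * a) v
    have h2 := rayMeasure_isOnRay a v
    have := rayMeasure_hasTemperateGrowth ha hv
    have := rayMeasure_hasTemperateGrowth hk hv
    have := h1.hasTemperateGrowth_conv h2
    have hconv : Measure.conv (rayMeasure ((k + 1 : ℕ) * a) v) (rayMeasure a v) =
        rayMeasure ((k + 1 + 1 : ℕ) * a) v := by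
      rw [rayMeasure_conv hk ha]
      congr 1
      push_cast
      ring
    have h3 := h1.isFourierProduct h2 (α ^ (k + 1)) α
    have h4 := h1.isHormanderProduct h2 (α ^ (k + 1)) α
    rw [hconv, ← pow_succ] at h3 h4
    exact ih.succ h3 h4

/-- On the spectral side the derivative is multiplication by 2πi r⟨v, m⟩, and the factor r is
absorbed by `integral_smul_rieszMeasure`. -/
theorem lineDerivOp_homogeneousWave (ha : 0 < a) (hv : v ≠ 0) (m : E) :
    ∂_{m} (homogeneousWave a v) =
      (2 * Real.pi * Complex.I * (inner ℝ v m : ℝ) * a) • homogeneousWave (a + 1) v := by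
  ext φ
  have htg : (inner ℝ · m : E → ℝ).HasTemperateGrowth := by fun_prop
  have h : ∀ r : ℝ, 𝓕⁻ (-∂_{m} φ) (r • v) =
      r • ((2 * Real.pi * Complex.I * (inner ℝ v m : ℝ)) * 𝓕⁻ φ (r • v)) := by
    intro r
    rw [FourierTransform.fourierInv_neg, SchwartzMap.fourierInv_lineDerivOp_eq]
    simp only [_root_.neg_apply, _root_.smul_apply,
      SchwartzMap.smulLeftCLM_apply_apply htg, real_inner_smul_left, Complex.real_smul, smul_eq_mul]
    push_cast
    ring
  rw [TemperedDistribution.lineDerivOp_apply_apply, homogeneousWave_apply ha hv]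
  simp_rw [h]
  rw [integral_smul_rieszMeasure ha, integral_const_mul]
  change _ = _ * homogeneousWave (a + 1) v φ
  rw [homogeneousWave_apply (by positivity) hv, Complex.real_smul]
  ring

theorem lineDerivOp_lineDerivOp_homogeneousWave (ha : 0 < a) (hv : v ≠ 0) (m : E) (α : ℂ) :
    ∂_{m} (∂_{m} (α • homogeneousWave a v)) =
      (-α * (4 * Real.pi ^ 2 * inner ℝ v m ^ 2 * (a * (a + 1)) : ℝ)) •
        homogeneousWave (a + 2) v := by
  rw [LineDeriv.lineDerivOp_smul, LineDeriv.lineDerivOp_smul, lineDerivOp_homogeneousWave ha hv,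
    LineDeriv.lineDerivOp_smul, lineDerivOp_homogeneousWave (by positivity) hv, smul_smul,
    smul_smul, add_assoc, one_add_one_eq_two]
  congr 1
  push_cast
  ring_nf
  rw [Complex.I_sq]
  ring

theorem derivCLM_homogeneousWave {a : ℝ} (ha : 0 < a) :
    derivCLM ℂ (homogeneousWave a (1 : ℝ)) =
      (2 * Real.pi * Complex.I * a) • homogeneousWave (a + 1) (1 : ℝ) := by
  have h := lineDerivOp_homogeneousWave ha (one_ne_zero (α := ℝ)) 1
  have hi : inner ℝ (1 : ℝ) 1 = 1 := by simp
  rw [hi, Complex.ofReal_one, mul_one] at h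
  rw [← h]
  ext φ
  rw [derivCLM_apply_apply, TemperedDistribution.lineDerivOp_apply_apply]
  congr 2

end

/-! ### Boundary values of powers -/

/-- The constant `c` with `(⟨x, v⟩ + i0)^(-a) = c ∫ e^{2πi r ⟨x, v⟩} r₊^(a-1) / Γ(a) dr`. -/
def waveConst (a : ℝ) : ℂ := (-(2 * Real.pi) * Complex.I) ^ (a : ℂ)

theorem neg_two_pi_I_ne_zero : -(2 * Real.pi) * Complex.I ≠ 0 := by
  simp [Real.pi_ne_zero]

theorem waveConst_ne_zero (a : ℝ) : waveConst a ≠ 0 := by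
  simp [waveConst, Complex.cpow_eq_zero_iff, Real.pi_ne_zero]

/-- The Laplace transform of the Riesz measure at -2πi(x + iε), whose real part 2πε is positive. -/
theorem cpow_add_mul_I {a : ℝ} (ha : 0 < a) (x : ℝ) {ε : ℝ} (hε : 0 < ε) :
    ((x : ℂ) + ε * Complex.I) ^ (-a : ℂ) = waveConst a *
      ∫ r : ℝ, Complex.exp (2 * Real.pi * Complex.I * (r * x : ℝ)) *
        Real.exp (-(2 * Real.pi * ε) * r) ∂(rieszMeasure a) := by
  set w : ℂ := (x : ℂ) + ε * Complex.I with hw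
  set m : ℂ := -(2 * Real.pi) * Complex.I with hm
  have hpi := Real.pi_pos
  have him : w.im = ε := by simp [hw]
  have hw0 : w ≠ 0 := fun h ↦ by rw [h] at him; simp at him; linarith
  have hm0 : m ≠ 0 := neg_two_pi_I_ne_zero
  have hre : 0 < (m * w).re := by
    simp [hm, hw]
    positivity
  -- No branch is crossed: arg m = -π/2 and arg w lies in [0, π], so the sum stays in (-π, π].
  have hlog : Complex.log (m * w) = Complex.log m + Complex.log w := by
    rw [Complex.log_mul_eq_add_log_iff hm0 hw0]
    have h1 : Complex.arg m = -(Real.pi / 2) := by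
      have : m = ((2 * Real.pi : ℝ) : ℂ) * -Complex.I := by rw [hm]; push_cast; ring
      rw [this, Complex.arg_real_mul _ (by positivity), Complex.arg_neg_I]
    have h2 : 0 ≤ Complex.arg w := Complex.arg_nonneg_iff.2 (by rw [him]; exact hε.le)
    have h3 := Complex.arg_le_pi w
    rw [h1]
    constructor <;> linarith
  have hmul : (m * w) ^ (-a : ℂ) = m ^ (-a : ℂ) * w ^ (-a : ℂ) := by
    rw [Complex.cpow_def_of_ne_zero (mul_ne_zero hm0 hw0), hlog, add_mul, Complex.exp_add,
      Complex.cpow_def_of_ne_zero hm0, Complex.cpow_def_of_ne_zero hw0]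
  have hint := integral_cexp_rieszMeasure ha hre
  rw [hmul] at hint
  have hone : waveConst a * m ^ (-a : ℂ) = 1 := by
    rw [waveConst, ← hm, ← Complex.cpow_add _ _ hm0, add_neg_cancel, Complex.cpow_zero]
  calc w ^ (-a : ℂ) = waveConst a * (m ^ (-a : ℂ) * w ^ (-a : ℂ)) := by
        rw [← mul_assoc, hone, one_mul]
    _ = _ := by
      rw [← hint]
      congr 2
      ext r
      rw [Complex.ofReal_exp, ← Complex.exp_add]
      congr 1
      simp only [hm, hw]
      push_cast
      ring_nf
      rw [Complex.I_sq]
      ring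

theorem tendsto_cpow_add_mul_I {x : ℝ} (hx : x ≠ 0) (l : ℂ) :
    Tendsto (fun ε : ℝ ↦ ((x : ℂ) + ε * Complex.I) ^ l) (𝓝[>] 0) (𝓝 ((x : ℂ) ^ l)) := by
  have hx' : (x : ℂ) ≠ 0 := Complex.ofReal_ne_zero.2 hx
  -- The approach stays in the closed upper half-plane, from which the principal logarithm is
  -- continuous up to its cut on the negative axis.
  have hpath : Tendsto (fun ε : ℝ ↦ (x : ℂ) + ε * Complex.I) (𝓝[>] 0)
      (𝓝[{z | 0 ≤ z.im}] (x : ℂ)) := by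
    refine tendsto_nhdsWithin_iff.2 ⟨?_, ?_⟩
    · have : Continuous fun ε : ℝ ↦ (x : ℂ) + ε * Complex.I := by fun_prop
      have := (this.tendsto 0).mono_left (nhdsWithin_le_nhds (s := Set.Ioi 0))
      simpa using this
    · filter_upwards [self_mem_nhdsWithin] with ε hε
      have : 0 < ε := hε
      simpa using this.le
  have hlog : Tendsto Complex.log (𝓝[{z | 0 ≤ z.im}] (x : ℂ)) (𝓝 (Complex.log x)) := by
    rcases hx.lt_or_gt with h | h
    · exact Complex.continuousWithinAt_log_of_re_neg_of_im_zero (by simpa) (by simp)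
    · exact (continuousAt_clog (Complex.ofReal_mem_slitPlane.2 h)).tendsto.mono_left
        nhdsWithin_le_nhds
  have h := ((hlog.comp hpath).mul_const l).cexp
  rw [Complex.cpow_def_of_ne_zero hx']
  refine h.congr' ?_
  filter_upwards [self_mem_nhdsWithin] with ε hε
  have h0 : (x : ℂ) + ε * Complex.I ≠ 0 := by
    intro h
    apply hx
    simpa using congrArg Complex.re h
  rw [Complex.cpow_def_of_ne_zero h0]
  rfl

theorem contDiffAt_ofReal_cpow {x : ℝ} (hx : x ≠ 0) (l : ℂ) :
    ContDiffAt ℝ ∞ (fun x : ℝ ↦ (x : ℂ) ^ l) x := by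
  have hpos : ∀ {y : ℝ}, 0 < y → ContDiffAt ℝ ∞ (fun x : ℝ ↦ (x : ℂ) ^ l) y := by
    intro y hy
    have h1 : ContDiffAt ℝ ∞ (fun x : ℝ ↦ Complex.exp (Complex.log x * l)) y := by
      refine (Complex.contDiff_exp (𝕜 := ℝ)).contDiffAt.comp y ?_
      refine ContDiffAt.mul ?_ contDiffAt_const
      exact ((Complex.contDiffAt_log (Complex.ofReal_mem_slitPlane.2 hy)).restrict_scalars ℝ).comp y
        Complex.ofRealCLM.contDiff.contDiffAt
    refine h1.congr_of_eventuallyEq ?_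
    filter_upwards [Ioi_mem_nhds hy] with z hz
    exact Complex.cpow_def_of_ne_zero (Complex.ofReal_ne_zero.2 (ne_of_gt hz)) l
  rcases hx.lt_or_gt with h | h
  · have h1 : ContDiffAt ℝ ∞
        (fun x : ℝ ↦ ((-x : ℝ) : ℂ) ^ l * Complex.exp (Real.pi * Complex.I * l))
        x := by
      refine ContDiffAt.mul ?_ contDiffAt_const
      exact (hpos (neg_pos.2 h)).comp x contDiff_neg.contDiffAt
    refine h1.congr_of_eventuallyEq ?_
    filter_upwards [Iio_mem_nhds h] with z hz
    rw [Complex.ofReal_cpow_of_nonpos (le_of_lt hz)]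
    push_cast
    rfl
  · exact hpos h

section

variable {E : Type} [NormedAddCommGroup E] [InnerProductSpace ℝ E]

theorem isOpen_inner_ne_zero (v : E) : IsOpen {z : E | inner ℝ z v ≠ 0} :=
  isOpen_ne_fun (by fun_prop) continuous_const

theorem contDiffOn_inner_cpow (v : E) (l : ℂ) :
    ContDiffOn ℝ ∞ (fun z : E ↦ ((inner ℝ z v : ℝ) : ℂ) ^ l) {z | inner ℝ z v ≠ 0} :=
  fun z hz ↦ ((contDiffAt_ofReal_cpow hz l).comp z
    (contDiff_id.inner ℝ contDiff_const).contDiffAt).contDiffWithinAt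

variable [FiniteDimensional ℝ E]
  [MeasurableSpace E] [BorelSpace E] {a : ℝ} {v : E}

theorem integrable_fourierInv_smul (ha : 0 < a) (hv : v ≠ 0) (φ : 𝓢(E, ℂ)) :
    Integrable (fun r : ℝ ↦ 𝓕⁻ φ (r • v)) (rieszMeasure a) := by
  have := rayMeasure_hasTemperateGrowth ha hv
  have h := integrable_translate (rayMeasure a v) (𝓕⁻ φ) 0
  rw [rayMeasure, (measurableEmbedding_smul_left hv).integrable_map_iff] at h
  simpa [Function.comp_def] using h

/-- The damping factor makes the double integral in z and r absolutely convergent, so Fubini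
applies. -/
theorem integral_mul_cpow_add_mul_I (ha : 0 < a) (φ : 𝓢(E, ℂ)) {ε : ℝ} (hε : 0 < ε) :
    ∫ z, φ z * ((inner ℝ z v : ℝ) + ε * Complex.I) ^ (-a : ℂ) =
      waveConst a *
        ∫ r, 𝓕⁻ φ (r • v) * Real.exp (-(2 * Real.pi * ε) * r) ∂(rieszMeasure a) := by
  have hpi := Real.pi_pos
  have hexp := integrable_exp_rieszMeasure ha (show 0 < 2 * Real.pi * ε by positivity)
  have hint : Integrable (fun q : E × ℝ ↦ φ q.1 *
      (Complex.exp (2 * Real.pi * Complex.I * (q.2 * inner ℝ q.1 v : ℝ)) *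
        Real.exp (-(2 * Real.pi * ε) * q.2))) ((volume : Measure E).prod (rieszMeasure a)) := by
    refine (φ.integrable.norm.mul_prod hexp).mono'
      (Continuous.aestronglyMeasurable (by fun_prop)) (Eventually.of_forall fun q ↦ ?_)
    rw [norm_mul, norm_mul, Complex.norm_real, Real.norm_of_nonneg (Real.exp_pos _).le]
    have : ‖Complex.exp (2 * Real.pi * Complex.I * (q.2 * inner ℝ q.1 v : ℝ))‖ = 1 := by
      simp [Complex.norm_exp]
    rw [this, one_mul]
  simp_rw [cpow_add_mul_I ha _ hε]
  calc ∫ z, φ z * (waveConst a * ∫ r : ℝ,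
        Complex.exp (2 * Real.pi * Complex.I * (r * inner ℝ z v : ℝ)) *
          Real.exp (-(2 * Real.pi * ε) * r) ∂(rieszMeasure a))
      = waveConst a * ∫ z, ∫ r : ℝ, φ z *
        (Complex.exp (2 * Real.pi * Complex.I * (r * inner ℝ z v : ℝ)) *
          Real.exp (-(2 * Real.pi * ε) * r)) ∂(rieszMeasure a) := by
        rw [← integral_const_mul]
        congr 1
        ext z
        rw [integral_const_mul]
        ring
    _ = waveConst a * ∫ r : ℝ, (∫ z, φ z *
        (Complex.exp (2 * Real.pi * Complex.I * (r * inner ℝ z v : ℝ)) *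
          Real.exp (-(2 * Real.pi * ε) * r))) ∂(rieszMeasure a) := by
        rw [integral_integral_swap (f := fun (z : E) (r : ℝ) ↦ φ z *
          (Complex.exp (2 * Real.pi * Complex.I * (r * inner ℝ z v : ℝ)) *
            Real.exp (-(2 * Real.pi * ε) * r))) hint]
    _ = _ := by
        congr 2
        ext r
        rw [fourierInv_apply, ← integral_mul_const]
        congr 1
        ext z
        rw [real_inner_smul_right]
        ring

/-- `(⟨z, v⟩ + iε)^(-a)` converges to a multiple of the homogeneous wave as `ε ↓ 0`. -/
theorem tendsto_integral_mul_cpow (ha : 0 < a) (hv : v ≠ 0) (φ : 𝓢(E, ℂ)) :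
    Tendsto (fun ε : ℝ ↦ ∫ z, φ z * ((inner ℝ z v : ℝ) + ε * Complex.I) ^ (-a : ℂ)) (𝓝[>] 0)
      (𝓝 (waveConst a * homogeneousWave a v φ)) := by
  have hpi := Real.pi_pos
  have h : Tendsto (fun ε : ℝ ↦ waveConst a *
      ∫ r, 𝓕⁻ φ (r • v) * Real.exp (-(2 * Real.pi * ε) * r) ∂(rieszMeasure a)) (𝓝[>] 0)
      (𝓝 (waveConst a * homogeneousWave a v φ)) := by
    rw [homogeneousWave_apply ha hv]
    refine Tendsto.const_mul _ ?_
    have hI := integrable_fourierInv_smul ha hv φ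
    refine tendsto_integral_filter_of_dominated_convergence (fun r ↦ ‖𝓕⁻ φ (r • v)‖) ?_ ?_
      hI.norm ?_
    · exact Eventually.of_forall fun ε ↦
        hI.aestronglyMeasurable.mul (Continuous.aestronglyMeasurable (by fun_prop))
    · filter_upwards [self_mem_nhdsWithin] with ε hε
      have hε' : 0 < ε := hε
      filter_upwards [ae_rieszMeasure_pos a] with r hr
      rw [norm_mul, Complex.norm_real, Real.norm_of_nonneg (Real.exp_pos _).le]
      refine mul_le_of_le_one_right (norm_nonneg _) (Real.exp_le_one_iff.2 ?_)
      have : 0 ≤ 2 * Real.pi * ε * r := by positivity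
      linarith
    · filter_upwards with r
      have hc : Continuous fun ε : ℝ ↦
          𝓕⁻ φ (r • v) * (Real.exp (-(2 * Real.pi * ε) * r) : ℂ) := by fun_prop
      have := (hc.tendsto 0).mono_left (nhdsWithin_le_nhds (s := Set.Ioi 0))
      simpa using this
  refine h.congr' ?_
  filter_upwards [self_mem_nhdsWithin] with ε hε
  exact (integral_mul_cpow_add_mul_I ha φ hε).symm

/-! ### The singular support -/

/-- Off the hyperplane `⟨z, v⟩ = 0`, the homogeneous wave is a multiple of the function
`⟨z, v⟩^(-a)`. -/
theorem homogeneousWave_apply_eq_integral (ha : 0 < a) (hv : v ≠ 0) {φ : 𝓢(E, ℂ)}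
    (hφ : HasCompactSupport φ) (hs : tsupport φ ⊆ {z : E | inner ℝ z v ≠ 0}) :
    waveConst a * homogeneousWave a v φ =
      ∫ z, φ z * ((inner ℝ z v : ℝ) : ℂ) ^ (-a : ℂ) := by
  refine tendsto_nhds_unique (tendsto_integral_mul_cpow ha hv φ) ?_
  -- The compact support keeps a distance δ from the hyperplane, so δ^(-a) bounds the powers
  -- uniformly in ε.
  obtain ⟨δ, hδ, hle⟩ := hφ.isCompact.exists_forall_le' (f := fun z ↦ |inner ℝ z v|) (a := 0)
    (Continuous.continuousOn (by fun_prop)) fun z hz ↦ abs_pos.2 (hs hz)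
  refine tendsto_integral_filter_of_dominated_convergence (fun z ↦ ‖φ z‖ * δ ^ (-a)) ?_ ?_
    (φ.integrable.norm.mul_const _) ?_
  · refine Eventually.of_forall fun ε ↦ φ.continuous.aestronglyMeasurable.mul ?_
    refine Measurable.aestronglyMeasurable ?_
    fun_prop
  · refine Eventually.of_forall fun ε ↦ Eventually.of_forall fun z ↦ ?_
    rw [norm_mul]
    by_cases hz : z ∈ tsupport φ
    · rw [← Complex.ofReal_neg a, Complex.norm_cpow_real]
      refine mul_le_mul_of_nonneg_left (Real.rpow_le_rpow_of_nonpos hδ ?_ (by linarith))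
        (norm_nonneg _)
      refine (hle z hz).trans ?_
      have := Complex.abs_re_le_norm (((inner ℝ z v : ℝ) : ℂ) + ε * Complex.I)
      simpa using this
    · simp [image_eq_zero_of_notMem_tsupport hz]
  · refine Eventually.of_forall fun z ↦ ?_
    by_cases hz : z ∈ tsupport φ
    · exact (tendsto_cpow_add_mul_I (hs hz) _).const_mul _
    · simp [image_eq_zero_of_notMem_tsupport hz]

theorem integrable_mul_of_continuousOn {φ f : E → ℂ} {Ω : Set E} (hφ : Continuous φ)
    (hc : HasCompactSupport φ) (hs : tsupport φ ⊆ Ω) (hf : ContinuousOn f Ω) :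
    Integrable (fun z ↦ φ z * f z) := by
  rw [← integrableOn_iff_integrable_of_support_subset (s := tsupport φ)
    ((Function.support_mul_subset_left φ f).trans (subset_tsupport φ))]
  exact (hφ.continuousOn.mul (hf.mono hs)).integrableOn_compact hc.isCompact

/-- Continuous functions that define the same distribution on an open set agree there. -/
theorem eqOn_of_integral_mul_eq {f g : E → ℂ} {Ω : Set E} (hΩ : IsOpen Ω) (hf : ContinuousOn f Ω)
    (hg : ContinuousOn g Ω) (h : ∀ φ : 𝓢(E, ℂ), HasCompactSupport φ → tsupport φ ⊆ Ω →
      ∫ z, φ z * f z = ∫ z, φ z * g z) : Set.EqOn f g Ω := by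
  have hae := hΩ.ae_eq_zero_of_integral_contDiff_smul_eq_zero (μ := volume) (f := fun z ↦ f z - g z)
    ((hf.sub hg).locallyIntegrableOn hΩ.measurableSet) fun ψ hψ hc hs ↦ by
      have h1 : HasCompactSupport (fun y ↦ (ψ y : ℂ)) := hc.comp_left (g := ((↑) : ℝ → ℂ)) rfl
      have h2 : ContDiff ℝ ∞ (fun y ↦ (ψ y : ℂ)) := Complex.ofRealCLM.contDiff.comp hψ
      have h3 : tsupport (fun y ↦ (ψ y : ℂ)) ⊆ Ω :=
        (closure_mono (Function.support_comp_subset (g := ((↑) : ℝ → ℂ)) rfl ψ)).trans hs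
      have h4 := h (h1.toSchwartzMap h2) h1 h3
      simp_rw [Complex.real_smul, mul_sub]
      rw [integral_sub (integrable_mul_of_continuousOn h2.continuous h1 h3 hf)
        (integrable_mul_of_continuousOn h2.continuous h1 h3 hg), sub_eq_zero]
      exact h4
  refine Measure.eqOn_open_of_ae_eq (μ := volume) ?_ hΩ hf hg
  rw [EventuallyEq, ae_restrict_iff' hΩ.measurableSet]
  filter_upwards [hae] with z hz hzΩ
  exact sub_eq_zero.1 (hz hzΩ)

theorem singularSupport_homogeneousWave (ha : 0 < a) (hv : v ≠ 0) {K : ℂ} (hK : K ≠ 0) :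
    singularSupport (K • homogeneousWave a v) = {z : E | inner ℝ z v = 0} := by
  set g : E → ℂ := fun z ↦ K * (waveConst a)⁻¹ * ((inner ℝ z v : ℝ) : ℂ) ^ (-a : ℂ) with hgdef
  have hgs : ContDiffOn ℝ ∞ g {z | inner ℝ z v ≠ 0} :=
    contDiffOn_const.mul (contDiffOn_inner_cpow v _)
  have hgi : ∀ φ : 𝓢(E, ℂ), HasCompactSupport φ → tsupport φ ⊆ {z : E | inner ℝ z v ≠ 0} →
      (K • homogeneousWave a v) φ = ∫ z, φ z * g z := by
    intro φ hφ hs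
    have h1 : ∀ z, φ z * g z =
        K * (waveConst a)⁻¹ * (φ z * ((inner ℝ z v : ℝ) : ℂ) ^ (-a : ℂ)) := fun z ↦ by
      simp only [hgdef]; ring
    simp_rw [h1]
    rw [integral_const_mul, ← homogeneousWave_apply_eq_integral ha hv hφ hs, mul_assoc,
      inv_mul_cancel_left₀ (waveConst_ne_zero a)]
    rfl
  ext z₀
  constructor
  · intro hz
    by_contra h0
    exact hz ⟨_, isOpen_inner_ne_zero v, h0, g, hgs, hgi⟩
  · rintro hz₀ ⟨Ω, hΩ, hzΩ, f, hf, hfi⟩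
    have hz₀' : inner ℝ z₀ v = 0 := hz₀
    have hv2 : 0 < inner ℝ v v := real_inner_self_pos.2 hv
    have heq : Set.EqOn f g (Ω ∩ {z | inner ℝ z v ≠ 0}) :=
      eqOn_of_integral_mul_eq (hΩ.inter (isOpen_inner_ne_zero v))
        (hf.continuousOn.mono Set.inter_subset_left) (hgs.continuousOn.mono Set.inter_subset_right)
        fun φ hc hs ↦ by
          rw [← hfi φ hc (hs.trans Set.inter_subset_left),
            ← hgi φ hc (hs.trans Set.inter_subset_right)]
    -- A smooth f near z₀ would have to agree with g off the hyperplane; along z₀ + t v, however,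
    -- |g| is a positive multiple of t^(-a), hence unbounded.
    have hpath : Tendsto (fun t : ℝ ↦ z₀ + t • v) (𝓝[>] 0) (𝓝 z₀) := by
      have hc : Continuous fun t : ℝ ↦ z₀ + t • v := by fun_prop
      have := (hc.tendsto 0).mono_left (nhdsWithin_le_nhds (s := Set.Ioi 0))
      simpa using this
    have hlim : Tendsto (fun t : ℝ ↦ ‖f (z₀ + t • v)‖) (𝓝[>] 0) (𝓝 ‖f z₀‖) :=
      ((hf.continuousOn.continuousAt (hΩ.mem_nhds hzΩ)).tendsto.comp hpath).norm
    have htop : Tendsto (fun t : ℝ ↦ ‖K * (waveConst a)⁻¹‖ * inner ℝ v v ^ (-a) * t ^ (-a))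
        (𝓝[>] 0) atTop := by
      refine Tendsto.const_mul_atTop ?_ (tendsto_rpow_neg_nhdsGT_zero (by linarith))
      have : 0 < ‖K * (waveConst a)⁻¹‖ :=
        norm_pos_iff.2 (mul_ne_zero hK (inv_ne_zero (waveConst_ne_zero a)))
      positivity
    refine not_tendsto_nhds_of_tendsto_atTop htop _ (hlim.congr' ?_)
    filter_upwards [hpath.eventually_mem (hΩ.mem_nhds hzΩ), self_mem_nhdsWithin] with t ht ht0
    have ht0' : 0 < t := ht0
    have hin : inner ℝ (z₀ + t • v) v = t * inner ℝ v v := by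
      rw [inner_add_left, hz₀', real_inner_smul_left, zero_add]
    have hmem : z₀ + t • v ∈ Ω ∩ {z | inner ℝ z v ≠ 0} :=
      ⟨ht, show inner ℝ (z₀ + t • v) v ≠ 0 by rw [hin]; positivity⟩
    rw [heq hmem]
    simp only [hgdef, hin]
    rw [norm_mul, ← Complex.ofReal_neg a, Complex.norm_cpow_real, Complex.norm_real,
      Real.norm_of_nonneg (by positivity), Real.mul_rpow ht0'.le hv2.le]
    ring

end

/-! ### Affine pullbacks of homogeneous waves on the line -/

theorem exists_comp_affine {α : ℝ} (hα : α ≠ 0) (b : ℝ) (φ : 𝓢(ℝ, ℂ)) :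
    ∃ ψ : 𝓢(ℝ, ℂ), ∀ x, ψ x = φ ((x - b) / α) :=
  ⟨SchwartzMap.compSubConstCLM ℂ b (SchwartzMap.compCLMOfContinuousLinearEquiv ℂ
    (ContinuousLinearEquiv.unitsEquivAut ℝ (Units.mk0 α hα)⁻¹) φ), fun x ↦ by
      simp [div_eq_mul_inv]⟩

theorem fourierInv_apply_real (f : 𝓢(ℝ, ℂ)) (y : ℝ) :
    𝓕⁻ f y = ∫ x : ℝ, Complex.exp (2 * Real.pi * Complex.I * (x * y : ℝ)) * f x := by
  rw [fourierInv_apply]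
  simp [mul_comm]

/-- The translation becomes a phase, the dilation rescales the frequency, and |α|⁻¹ cancels the
Jacobian. -/
theorem affinePullback_homogeneousWave_apply {a α : ℝ} (ha : 0 < a) (hα : α ≠ 0) (b : ℝ) (K : ℂ)
    (φ : 𝓢(ℝ, ℂ)) :
    affinePullback α b (K • homogeneousWave a (1 : ℝ)) φ =
      K * ∫ r : ℝ, Complex.exp (2 * Real.pi * Complex.I * (r * b : ℝ)) * 𝓕⁻ φ (r * α)
        ∂(rieszMeasure a) := by
  obtain ⟨ψ, hψ⟩ := exists_comp_affine hα b φ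
  rw [affinePullback_apply hα b _ φ ψ hψ]
  change _ * (K * homogeneousWave a (1 : ℝ) ψ) = _
  rw [homogeneousWave_apply ha one_ne_zero, mul_left_comm, ← integral_const_mul]
  congr 2
  ext r
  have hα' : ((|α| : ℝ) : ℂ) ≠ 0 := by simpa using hα
  have h : 𝓕⁻ ψ (r • (1 : ℝ)) = ∫ x : ℝ, (fun y : ℝ ↦
      Complex.exp (2 * Real.pi * Complex.I * ((α * y + b) * r : ℝ)) * φ y) ((x - b) / α) := by
    rw [fourierInv_apply_real]
    congr 1
    ext x
    have : α * ((x - b) / α) = x - b := by field_simp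
    simp only [hψ, smul_eq_mul, mul_one, this, sub_add_cancel]
  rw [h, integral_sub_right_eq_self (fun x ↦ (fun y : ℝ ↦
      Complex.exp (2 * Real.pi * Complex.I * ((α * y + b) * r : ℝ)) * φ y) (x / α)) b,
    Measure.integral_comp_div (fun y : ℝ ↦
      Complex.exp (2 * Real.pi * Complex.I * ((α * y + b) * r : ℝ)) * φ y) α,
    fourierInv_apply_real, Complex.real_smul, ← mul_assoc, Complex.ofReal_inv, inv_mul_cancel₀ hα', one_mul,
    ← integral_const_mul]
  congr 1
  ext x
  rw [← mul_assoc, ← Complex.exp_add]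
  congr 2
  push_cast
  ring

theorem boostedProfile_homogeneousWave_apply {a c e : ℝ} (ha : 0 < a)
    (hα : e / √|1 - c ^ 2| ≠ 0) (A K : ℂ) (t : ℝ) (φ : 𝓢(ℝ, ℂ)) :
    boostedProfile c e A (K • homogeneousWave a (1 : ℝ)) t φ =
      A * K * ∫ r : ℝ, Complex.exp (2 * Real.pi * Complex.I * (r * (c / √|1 - c ^ 2| * t) : ℝ)) *
        𝓕⁻ φ (r * (e / √|1 - c ^ 2|)) ∂(rieszMeasure a) := by
  change A * affinePullback _ _ _ φ = _
  rw [affinePullback_homogeneousWave_apply ha hα, ← mul_assoc A K, mul_div_right_comm]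

/-! ### Time slices -/

theorem slice_apply_sliceMap (t : ℝ) (φ : 𝓢(Spacetime, ℂ)) (x : ℝ) :
    slice t φ x = φ (sliceMap t x) := rfl

theorem lineDerivOp_slice (t : ℝ) (φ : 𝓢(Spacetime, ℂ)) :
    ∂_{(1 : ℝ)} (slice t φ) = slice t (∂_{eX} φ) := by
  ext x
  rw [slice_apply_sliceMap, SchwartzMap.lineDerivOp_apply, SchwartzMap.lineDerivOp_apply, lineDeriv,
    lineDeriv]
  congr 1
  ext s
  rw [slice_apply_sliceMap]
  congr 1
  simp only [sliceMap, smul_eq_mul, mul_one, add_smul]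
  abel

theorem abs_mul_norm_fourierInv_slice (t : ℝ) (φ : 𝓢(Spacetime, ℂ)) (ξ : ℝ) :
    |ξ| * ‖𝓕⁻ (slice t φ) ξ‖ = (2 * Real.pi)⁻¹ * ‖𝓕⁻ (slice t (∂_{eX} φ)) ξ‖ := by
  have htg : (inner ℝ · (1 : ℝ) : ℝ → ℝ).HasTemperateGrowth := by fun_prop
  rw [← lineDerivOp_slice, SchwartzMap.fourierInv_lineDerivOp_eq, _root_.smul_apply,
    SchwartzMap.smulLeftCLM_apply_apply htg, norm_smul, norm_smul, norm_neg]
  have hpi := Real.pi_pos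
  simp [abs_of_pos hpi]
  field_simp

theorem norm_sliceMap_fst (t x : ℝ) : |x| ≤ ‖sliceMap t x‖ := by
  simpa [sliceMap] using PiLp.norm_apply_le (sliceMap t x) 0

theorem norm_sliceMap_snd (t x : ℝ) : |t| ≤ ‖sliceMap t x‖ := by
  simpa [sliceMap] using PiLp.norm_apply_le (sliceMap t x) 1

theorem weight_sliceMap_le (k l : ℕ) (t x : ℝ) :
    weight (k + l) (sliceMap t x) ≤ weight k t * weight l x := by
  rw [weight_add]
  refine mul_le_mul ?_ ?_ (weight_nonneg _ _) (weight_nonneg _ _)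
  · have := weight_le_of_le (k := k) (C := 1) (x := sliceMap t x) (y := t)
      (by rw [one_mul, Real.norm_eq_abs]; linarith [norm_sliceMap_snd t x])
    simpa using this
  · have := weight_le_of_le (k := l) (C := 1) (x := sliceMap t x) (y := x)
      (by rw [one_mul, Real.norm_eq_abs]; linarith [norm_sliceMap_fst t x])
    simpa using this

/-- Decay in t comes from φ itself; each power of ξ is traded for an x-derivative of φ. -/
theorem abs_pow_mul_norm_fourierInv_slice_le (l k : ℕ) (φ : 𝓢(Spacetime, ℂ)) :
    ∃ C, 0 ≤ C ∧ ∀ t ξ, |ξ| ^ k * ‖𝓕⁻ (slice t φ) ξ‖ ≤ C * weight l t := by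
  induction k generalizing φ with
  | zero =>
    obtain ⟨m, hm⟩ := exists_integrable_weight (volume : Measure ℝ)
    obtain ⟨C, hC, hφ⟩ := exists_norm_le_weight φ (l + m)
    have hI : 0 ≤ ∫ x : ℝ, weight m x := integral_nonneg fun x ↦ weight_nonneg m x
    refine ⟨C * ∫ x : ℝ, weight m x, by positivity, fun t ξ ↦ ?_⟩
    rw [pow_zero, one_mul, fourierInv_apply_real, mul_right_comm C, ← integral_const_mul]
    refine norm_integral_le_of_norm_le ((hm m le_rfl).const_mul (C * weight l t))
      (Eventually.of_forall fun x ↦ ?_)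
    have : ‖Complex.exp (2 * Real.pi * Complex.I * (x * ξ : ℝ))‖ = 1 := by
      simp [Complex.norm_exp]
    rw [norm_mul, this, one_mul, slice_apply_sliceMap, mul_assoc]
    refine (hφ _).trans ?_
    gcongr
    exact weight_sliceMap_le l m t x
  | succ k ih =>
    obtain ⟨C, hC, h⟩ := ih (∂_{eX} φ)
    have hpi := Real.pi_pos
    refine ⟨(2 * Real.pi)⁻¹ * C, by positivity, fun t ξ ↦ ?_⟩
    rw [pow_succ, mul_assoc, abs_mul_norm_fourierInv_slice, mul_left_comm, mul_assoc]
    exact mul_le_mul_of_nonneg_left (h t ξ) (by positivity)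

theorem norm_fourierInv_slice_le (l k : ℕ) (φ : 𝓢(Spacetime, ℂ)) :
    ∃ C, 0 ≤ C ∧ ∀ t ξ, ‖𝓕⁻ (slice t φ) ξ‖ ≤ C * (weight l t * weight k ξ) := by
  obtain ⟨C, hC, h⟩ := abs_pow_mul_norm_fourierInv_slice_le l 0 φ
  obtain ⟨D, hD, h'⟩ := abs_pow_mul_norm_fourierInv_slice_le l k φ
  refine ⟨2 ^ (k - 1) * (C + D), by positivity, fun t ξ ↦ ?_⟩
  have hw : weight k ξ = ((1 + ‖ξ‖) ^ k)⁻¹ := rfl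
  rw [← mul_assoc, hw, ← div_eq_mul_inv, le_div_iff₀ (by positivity)]
  have h1 := h t ξ
  rw [pow_zero, one_mul] at h1
  have h2 := h' t ξ
  have h3 := add_pow_le zero_le_one (norm_nonneg ξ) k
  rw [one_pow] at h3
  calc ‖𝓕⁻ (slice t φ) ξ‖ * (1 + ‖ξ‖) ^ k
      ≤ ‖𝓕⁻ (slice t φ) ξ‖ * (2 ^ (k - 1) * (1 + ‖ξ‖ ^ k)) := by gcongr
    _ = 2 ^ (k - 1) * (‖𝓕⁻ (slice t φ) ξ‖ + |ξ| ^ k * ‖𝓕⁻ (slice t φ) ξ‖) := by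
        rw [Real.norm_eq_abs ξ]; ring
    _ ≤ 2 ^ (k - 1) * (C * weight l t + D * weight l t) := by gcongr
    _ = _ := by ring

/-- Integration over space-time, one time slice after the other. -/
theorem integral_spacetime {f : Spacetime → ℂ} (hf : Integrable f) :
    ∫ z, f z = ∫ t, ∫ x, f (sliceMap t x) := by
  have hmp : MeasurePreserving (fun p : ℝ × ℝ ↦ sliceMap p.2 p.1) volume volume := by
    have h1 := (volume_preserving_finTwoArrow ℝ).symm
    have h2 := (PiLp.volume_preserving_toLp (Fin 2)).comp h1
    have hfun : (fun p : ℝ × ℝ ↦ sliceMap p.2 p.1) =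
        WithLp.toLp 2 ∘ MeasurableEquiv.finTwoArrow.symm := by
      funext p
      refine PiLp.ext fun i ↦ ?_
      fin_cases i <;> simp [sliceMap, MeasurableEquiv.finTwoArrow, MeasurableEquiv.piFinTwo]
    rw [hfun]
    exact h2
  have hemb : MeasurableEmbedding fun p : ℝ × ℝ ↦ sliceMap p.2 p.1 := by
    have hcont : Continuous fun p : ℝ × ℝ ↦ sliceMap p.2 p.1 := by unfold sliceMap; fun_prop
    refine hcont.measurableEmbedding fun p q h ↦ ?_
    have h0 := congrArg (fun z : Spacetime ↦ z 0) h
    have h1 := congrArg (fun z : Spacetime ↦ z 1) h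
    simp [sliceMap] at h0 h1
    exact Prod.ext h0 h1
  rw [← hmp.integral_comp hemb, Measure.volume_eq_prod, integral_prod_symm]
  rw [← Measure.volume_eq_prod]
  exact (hmp.integrable_comp_emb hemb).2 hf

theorem fourierInv_smul_spacetime (φ : 𝓢(Spacetime, ℂ)) (α β r : ℝ) :
    𝓕⁻ φ (r • !₂[α, β]) =
      ∫ t : ℝ, Complex.exp (2 * Real.pi * Complex.I * (r * (β * t) : ℝ)) *
        𝓕⁻ (slice t φ) (r * α) := by
  rw [fourierInv_apply, integral_spacetime]
  · congr 1
    ext t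
    rw [fourierInv_apply_real, ← integral_const_mul]
    congr 1
    ext x
    rw [← mul_assoc, ← Complex.exp_add, slice_apply_sliceMap]
    congr 2
    have : inner ℝ (sliceMap t x) (r • !₂[α, β]) = r * (β * t) + x * (r * α) := by
      simp [PiLp.inner_apply, Fin.sum_univ_two, sliceMap]
      ring
    rw [this]
    push_cast
    ring
  · refine φ.integrable.norm.mono' (Continuous.aestronglyMeasurable (by fun_prop))
      (Eventually.of_forall fun z ↦ ?_)
    simp [Complex.norm_exp]

theorem measurable_fourierInv_slice (φ : 𝓢(Spacetime, ℂ)) (α : ℝ) :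
    StronglyMeasurable fun q : ℝ × ℝ ↦ 𝓕⁻ (slice q.1 φ) (q.2 * α) := by
  simp_rw [fourierInv_apply_real]
  refine StronglyMeasurable.integral_prod_right (f := fun q : ℝ × ℝ ↦ fun x : ℝ ↦
    Complex.exp (2 * Real.pi * Complex.I * (x * (q.2 * α) : ℝ)) * slice q.1 φ x) ?_
  refine Continuous.stronglyMeasurable ?_
  have h : Continuous fun p : (ℝ × ℝ) × ℝ ↦ φ (sliceMap p.1.1 p.2) := by
    unfold sliceMap
    fun_prop
  have h2 : Continuous fun p : (ℝ × ℝ) × ℝ ↦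
      Complex.exp (2 * Real.pi * Complex.I * (p.2 * (p.1.2 * α) : ℝ)) := by fun_prop
  exact h2.mul h

/-- The Fourier integral over space-time is computed slice by slice, the time variable leaving the
phase e^(2πi rβt). Joint decay of `𝓕⁻ (slice t φ)` in t and frequency permits exchanging the
integrals over t and r. -/
theorem hasTimeSlices_homogeneousWave {a α β : ℝ} (ha : 0 < a) (hα : α ≠ 0) (K : ℂ)
    {U : ℝ → 𝓢'(ℝ, ℂ)} (hU : ∀ t φ, U t φ = K * ∫ r : ℝ,
      Complex.exp (2 * Real.pi * Complex.I * (r * (β * t) : ℝ)) * 𝓕⁻ φ (r * α)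
        ∂(rieszMeasure a)) :
    HasTimeSlices (K • homogeneousWave a !₂[α, β]) U := by
  intro φ
  have hv : (!₂[α, β] : Spacetime) ≠ 0 := fun h ↦ hα (by simpa using congrArg (fun z ↦ z 0) h)
  obtain ⟨m, hm⟩ := exists_integrable_weight (volume : Measure ℝ)
  have := rayMeasure_hasTemperateGrowth ha hα
  obtain ⟨k, hk⟩ := exists_integrable_weight (rayMeasure a α)
  obtain ⟨C, hC, hφ⟩ := norm_fourierInv_slice_le m k φ
  have hk' : Integrable (fun r : ℝ ↦ weight k (r * α)) (rieszMeasure a) := by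
    have h := hk k le_rfl
    rwa [rayMeasure, (measurableEmbedding_smul_left hα).integrable_map_iff] at h
  have hint : Integrable (fun q : ℝ × ℝ ↦
      Complex.exp (2 * Real.pi * Complex.I * (q.2 * (β * q.1) : ℝ)) * 𝓕⁻ (slice q.1 φ) (q.2 * α))
      ((volume : Measure ℝ).prod (rieszMeasure a)) := by
    refine (((hm m le_rfl).mul_prod hk').const_mul C).mono' ?_ (Eventually.of_forall fun q ↦ ?_)
    · exact (Continuous.aestronglyMeasurable (by fun_prop)).mul
        (measurable_fourierInv_slice φ α).aestronglyMeasurable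
    · have : ‖Complex.exp (2 * Real.pi * Complex.I * (q.2 * (β * q.1) : ℝ))‖ = 1 := by
        simp [Complex.norm_exp]
      rw [norm_mul, this, one_mul]
      exact hφ _ _
  simp_rw [hU]
  refine ⟨hint.integral_prod_left.const_mul K, ?_⟩
  change K * homogeneousWave a _ φ = _
  rw [homogeneousWave_apply ha hv, integral_const_mul]
  simp_rw [fourierInv_smul_spacetime]
  rw [integral_integral_swap (f := fun t r : ℝ ↦
    Complex.exp (2 * Real.pi * Complex.I * (r * (β * t) : ℝ)) * 𝓕⁻ (slice t φ) (r * α)) hint]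

/-! ### Sobolev regularity of superpositions over a ray -/

theorem rpow_le_of_comparable {x y κ : ℝ} (b : ℝ) (hx : 0 < x) (hy : 0 < y) (hκ : 0 < κ)
    (h : x ≤ κ * y) (h' : y ≤ κ * x) : x ^ b ≤ κ ^ |b| * y ^ b := by
  rcases le_total 0 b with hb | hb
  · rw [abs_of_nonneg hb, ← Real.mul_rpow hκ.le hy.le]
    exact Real.rpow_le_rpow hx.le h hb
  · rw [abs_of_nonpos hb, Real.rpow_neg hκ.le, ← Real.inv_rpow hκ.le,
      ← Real.mul_rpow (by positivity) hy.le]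
    refine Real.rpow_le_rpow_of_nonpos (by positivity) ?_ hb
    rwa [inv_mul_le_iff₀ hκ]

theorem one_add_abs_rpow_le (b x y : ℝ) :
    (1 + |x|) ^ b ≤ (1 + |x - y|) ^ |b| * (1 + |y|) ^ b := by
  have key (u v : ℝ) : 1 + |u| ≤ (1 + |u - v|) * (1 + |v|) := by
    have := abs_add_le (u - v) v
    rw [sub_add_cancel] at this
    nlinarith [abs_nonneg (u - v), abs_nonneg v]
  refine rpow_le_of_comparable b (by positivity) (by positivity) (by positivity) (key x y) ?_
  rw [abs_sub_comm]
  exact key y x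

/-- Away from 0, r and 1 + |rα| are comparable; the indicator term accounts for the possible
singularity at 0. -/
theorem rpow_le_one_add_abs_rpow (b : ℝ) {α : ℝ} (hα : α ≠ 0) :
    ∃ C, 0 ≤ C ∧ ∀ r, 0 < r →
      r ^ b ≤ C * (1 + |r * α|) ^ b * (1 + (Set.Ioc 0 1).indicator (fun r ↦ r ^ b) r) := by
  have hα' := abs_pos.2 hα
  refine ⟨(1 + |α| + |α|⁻¹) ^ |b|, by positivity, fun r hr ↦ ?_⟩
  have hrα : |r * α| = r * |α| := by rw [abs_mul, abs_of_pos hr]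
  have hinv := inv_pos.2 hα'
  rcases le_or_gt r 1 with h1 | h1
  · rw [Set.indicator_of_mem (show r ∈ Set.Ioc 0 1 from ⟨hr, h1⟩)]
    have h := rpow_le_of_comparable (x := 1) (y := 1 + |r * α|) (κ := 1 + |α| + |α|⁻¹) b one_pos
      (by positivity) (by positivity) (by nlinarith [abs_nonneg (r * α)])
      (by rw [hrα]; nlinarith)
    rw [Real.one_rpow] at h
    nlinarith [Real.rpow_nonneg hr.le b]
  · rw [Set.indicator_of_notMem (by simp [h1]), add_zero, mul_one]
    refine rpow_le_of_comparable b hr (by positivity) (by positivity) ?_ ?_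
    · rw [hrα]
      have : |α|⁻¹ * (r * |α|) = r := by field_simp
      nlinarith [mul_pos hr hα', mul_pos (mul_pos hr hα') hα']
    · rw [hrα]
      nlinarith [mul_pos hr hinv]

/-- A Schwartz function concentrates the integral near rα = ξ, where the density has size |ξ|^(a-1).
The singularity at r = 0 is integrable because a > 0. -/
theorem integral_norm_ray_le {a α : ℝ} (ha : 0 < a) (hα : α ≠ 0) (h : 𝓢(ℝ, ℂ)) :
    ∃ C, 0 ≤ C ∧ ∀ ξ : ℝ, Integrable (fun r ↦ h (r * α - ξ)) (rieszMeasure a) ∧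
      ∫ r : ℝ, ‖h (r * α - ξ)‖ ∂(rieszMeasure a) ≤ C * (1 + |ξ|) ^ (a - 1) := by
  obtain ⟨m, hm⟩ := exists_integrable_weight (volume : Measure ℝ)
  obtain ⟨n, hn⟩ := exists_nat_ge |a - 1|
  -- The first n ≥ |a - 1| orders pay for replacing rα by ξ, the other m for integrability in r.
  obtain ⟨D, hD, hh⟩ := exists_norm_le_weight h (n + m)
  obtain ⟨C, hC, hr⟩ := rpow_le_one_add_abs_rpow (a - 1) hα
  have hG := Real.Gamma_pos_of_pos ha
  have hind : Integrable ((Set.Ioc (0 : ℝ) 1).indicator fun r : ℝ ↦ r ^ (a - 1)) :=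
    (intervalIntegral.intervalIntegrable_rpow' (a := 0) (b := 1)
      (show -1 < a - 1 by linarith)).1.integrable_indicator measurableSet_Ioc
  have hw (ξ : ℝ) : Integrable fun r : ℝ ↦ weight m (r * α - ξ) :=
    ((hm m le_rfl).comp_sub_right ξ).comp_mul_right' hα
  have hwint (ξ : ℝ) : ∫ r : ℝ, weight m (r * α - ξ) = |α⁻¹| * ∫ r : ℝ, weight m r := by
    rw [Measure.integral_comp_mul_right (fun x : ℝ ↦ weight m (x - ξ)) α,
      integral_sub_right_eq_self (fun x : ℝ ↦ weight m x) ξ, smul_eq_mul]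
  set ι : ℝ → ℝ := (Set.Ioc (0 : ℝ) 1).indicator fun r : ℝ ↦ r ^ (a - 1) with hι
  have hι0 (r : ℝ) : 0 ≤ ι r :=
    Set.indicator_nonneg (fun r hr ↦ Real.rpow_nonneg hr.1.le _) r
  set E := (Real.Gamma a)⁻¹ * (C * D) with hE
  have hE0 : 0 ≤ E := by positivity
  have hbound (ξ r : ℝ) : rieszDensity a r • ‖h (r * α - ξ)‖ ≤
      E * (1 + |ξ|) ^ (a - 1) * (weight m (r * α - ξ) + ι r) := by
    have hw1 : weight m (r * α - ξ) ≤ 1 := by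
      have := weight_anti (Nat.zero_le m) (r * α - ξ)
      simpa [weight] using this
    have hξ : 0 ≤ (1 + |ξ|) ^ (a - 1) := by positivity
    have hw0 := weight_nonneg m (r * α - ξ)
    rcases le_or_gt r 0 with hr0 | hr0
    · rw [rieszDensity_of_nonpos hr0, zero_smul]
      have := hι0 r
      positivity
    · have h1 : (1 + |r * α|) ^ (a - 1) * weight n (r * α - ξ) ≤ (1 + |ξ|) ^ (a - 1) := by
        rw [weight, ← div_eq_mul_inv, div_le_iff₀ (by positivity), mul_comm ((1 + |ξ|) ^ (a - 1))]
        refine (one_add_abs_rpow_le (a - 1) (r * α) ξ).trans ?_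
        refine mul_le_mul_of_nonneg_right ?_ hξ
        rw [← Real.rpow_natCast]
        exact Real.rpow_le_rpow_of_exponent_le (by simp) hn
      rw [rieszDensity_of_pos hr0, smul_eq_mul]
      have hwι : weight m (r * α - ξ) * (1 + ι r) ≤ weight m (r * α - ξ) + ι r := by
        nlinarith [hι0 r]
      have hι1 : 0 ≤ 1 + ι r := by linarith [hι0 r]
      calc r ^ (a - 1) / Real.Gamma a * ‖h (r * α - ξ)‖
          ≤ C * (1 + |r * α|) ^ (a - 1) * (1 + ι r) / Real.Gamma a *
            (D * (weight n (r * α - ξ) * weight m (r * α - ξ))) := by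
            rw [← weight_add]
            exact mul_le_mul (div_le_div_of_nonneg_right (hr r hr0) hG.le) (hh _) (norm_nonneg _)
              (by positivity)
        _ = E * ((1 + |r * α|) ^ (a - 1) * weight n (r * α - ξ)) *
              (weight m (r * α - ξ) * (1 + ι r)) := by rw [hE]; field_simp
        _ ≤ E * (1 + |ξ|) ^ (a - 1) * (weight m (r * α - ξ) + ι r) := by
            gcongr
  have hcont (ξ : ℝ) : Continuous fun r ↦ h (r * α - ξ) := h.continuous.comp (by fun_prop)
  have hint (ξ : ℝ) : Integrable (fun r ↦ ‖h (r * α - ξ)‖) (rieszMeasure a) := by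
    rw [integrable_rieszMeasure_iff ha]
    refine (((hw ξ).add hind).const_mul (E * (1 + |ξ|) ^ (a - 1))).mono'
      ((measurable_rieszDensity a).smul (hcont ξ).norm.measurable).aestronglyMeasurable ?_
    refine Eventually.of_forall fun r ↦ ?_
    rw [Real.norm_of_nonneg (smul_nonneg (rieszDensity_nonneg ha r) (norm_nonneg _))]
    exact hbound ξ r
  refine ⟨E * ((|α⁻¹| * ∫ r : ℝ, weight m r) + ∫ r, ι r), ?_, fun ξ ↦ ⟨?_, ?_⟩⟩
  · have h1 : 0 ≤ ∫ r : ℝ, weight m r := integral_nonneg fun r ↦ weight_nonneg m r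
    have h2 : 0 ≤ ∫ r, ι r := integral_nonneg hι0
    positivity
  · exact (integrable_norm_iff (hcont ξ).aestronglyMeasurable).1 (hint ξ)
  · rw [integral_rieszMeasure ha]
    calc ∫ r, rieszDensity a r • ‖h (r * α - ξ)‖
        ≤ ∫ r, E * (1 + |ξ|) ^ (a - 1) * (weight m (r * α - ξ) + ι r) :=
          integral_mono ((integrable_rieszMeasure_iff ha).1 (hint ξ))
            (((hw ξ).add hind).const_mul _) (hbound ξ)
      _ = _ := by
          rw [integral_const_mul, integral_add (hw ξ) hind, hwint]
          ring

/-- The function `ξ ↦ (1 + ξ²)^(s/2) ∫ m(r) h(rα - ξ) r₊^(a-1)/Γ(a) dr`. -/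
def rayDensity (s a α : ℝ) (h : 𝓢(ℝ, ℂ)) (m : ℝ → ℂ) (ξ : ℝ) : ℂ :=
  (((1 + ‖ξ‖ ^ 2) ^ (s / 2) : ℝ) : ℂ) * ∫ r : ℝ, m r * h (r * α - ξ) ∂(rieszMeasure a)

/-- This is where the Sobolev threshold arises: (1+|ξ|)^(s+a-1) is in L² as soon as 2(s + a - 1) <
-1. The majorant depends on the multiplier m only through its bound B, as dominated convergence
requires. -/
theorem exists_norm_rayDensity_le {s a α : ℝ} (ha : 0 < a) (hα : α ≠ 0) (hs : s < 1 / 2 - a)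
    (h : 𝓢(ℝ, ℂ)) (B : ℝ) :
    ∃ g : ℝ → ℝ, MemLp g 2 ∧ ∀ m : ℝ → ℂ, (∀ᵐ r ∂(rieszMeasure a), ‖m r‖ ≤ B) →
      ∀ ξ, ‖rayDensity s a α h m ξ‖ ≤ g ξ := by
  obtain ⟨C, hC, hh⟩ := integral_norm_ray_le ha hα h
  refine ⟨fun ξ ↦ 2 ^ |s| * |B| * C * (1 + ‖ξ‖) ^ (s + (a - 1)), ?_, fun m hm ξ ↦ ?_⟩
  · have hmeas : AEStronglyMeasurable (fun ξ : ℝ ↦ (1 + ‖ξ‖) ^ (s + (a - 1))) :=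
      Measurable.aestronglyMeasurable (by fun_prop)
    refine MemLp.const_mul ((memLp_two_iff_integrable_sq hmeas).2 ?_) _
    have := integrable_one_add_norm (E := ℝ) (μ := volume) (r := -(2 * (s + (a - 1))))
      (by simp; linarith)
    refine this.congr (Eventually.of_forall fun ξ ↦ ?_)
    rw [neg_neg]
    change _ = ((1 + ‖ξ‖) ^ (s + (a - 1))) ^ 2
    rw [← Real.rpow_natCast, ← Real.rpow_mul (by positivity)]
    push_cast
    ring_nf
  · have h1 : (1 + ‖ξ‖ ^ 2) ^ (s / 2) ≤ 2 ^ |s| * (1 + ‖ξ‖) ^ s := by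
      have h0 : (1 + ‖ξ‖ ^ 2) ^ (s / 2) = (√(1 + ‖ξ‖ ^ 2)) ^ s := by
        rw [Real.sqrt_eq_rpow, ← Real.rpow_mul (by positivity)]
        congr 1
        ring
      have hsq := Real.sq_sqrt (show 0 ≤ 1 + ‖ξ‖ ^ 2 by positivity)
      have hpos := Real.sqrt_pos.2 (show 0 < 1 + ‖ξ‖ ^ 2 by positivity)
      rw [h0]
      refine rpow_le_of_comparable s hpos (by positivity) two_pos ?_ ?_
      · refine abs_le_of_sq_le_sq' ?_ (by positivity) |>.2
        nlinarith [norm_nonneg ξ]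
      · refine abs_le_of_sq_le_sq' ?_ (by positivity) |>.2
        nlinarith [norm_nonneg ξ, sq_nonneg (‖ξ‖ - 1)]
    have h2 : ‖∫ r : ℝ, m r * h (r * α - ξ) ∂(rieszMeasure a)‖ ≤
        |B| * (C * (1 + ‖ξ‖) ^ (a - 1)) := by
      refine (norm_integral_le_of_norm_le ((hh ξ).1.norm.const_mul |B|) ?_).trans ?_
      · filter_upwards [hm] with r hr
        rw [norm_mul]
        exact mul_le_mul_of_nonneg_right (hr.trans (le_abs_self B)) (norm_nonneg _)
      · rw [integral_const_mul]
        exact mul_le_mul_of_nonneg_left (hh ξ).2 (abs_nonneg B)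
    rw [rayDensity, norm_mul, Complex.norm_real, Real.norm_of_nonneg (by positivity)]
    beta_reduce
    rw [Real.rpow_add (by positivity)]
    refine (mul_le_mul h1 h2 (norm_nonneg _) (by positivity)).trans (le_of_eq ?_)
    ring

theorem aestronglyMeasurable_rayDensity (s a α : ℝ) (h : 𝓢(ℝ, ℂ)) {m : ℝ → ℂ}
    (hm : Measurable m) : AEStronglyMeasurable (rayDensity s a α h m) := by
  unfold rayDensity
  refine AEStronglyMeasurable.mul (Measurable.aestronglyMeasurable (by fun_prop)) ?_
  refine StronglyMeasurable.aestronglyMeasurable ?_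
  refine StronglyMeasurable.integral_prod_right (f := fun ξ r : ℝ ↦ m r * h (r * α - ξ)) ?_
  have : Continuous fun p : ℝ × ℝ ↦ h (p.2 * α - p.1) := h.continuous.comp (by fun_prop)
  exact ((hm.comp measurable_snd).mul this.measurable).stronglyMeasurable

theorem memLp_rayDensity {s a α : ℝ} (ha : 0 < a) (hα : α ≠ 0) (hs : s < 1 / 2 - a)
    (h : 𝓢(ℝ, ℂ)) {m : ℝ → ℂ} (hm : Measurable m) {B : ℝ}
    (hB : ∀ᵐ r ∂(rieszMeasure a), ‖m r‖ ≤ B) : MemLp (rayDensity s a α h m) 2 := by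
  obtain ⟨g, hg, hgm⟩ := exists_norm_rayDensity_le ha hα hs h B
  exact hg.mono' (aestronglyMeasurable_rayDensity s a α h hm) (Eventually.of_forall (hgm m hB))

/-- Dominated convergence in L², for filters that need not be sequences. -/
theorem tendsto_toLp_of_dominated {X ι : Type*} [MeasurableSpace X] {μ : Measure X}
    {l : Filter ι} [l.IsCountablyGenerated] {F : ι → X → ℂ} {f : X → ℂ} {g : X → ℝ}
    (hF : ∀ i, MemLp (F i) 2 μ) (hf : MemLp f 2 μ) (hg : MemLp g 2 μ)
    (hFg : ∀ i, ∀ᵐ x ∂μ, ‖F i x‖ ≤ g x)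
    (hlim : ∀ᵐ x ∂μ, Tendsto (fun i ↦ F i x) l (𝓝 (f x))) :
    Tendsto (fun i ↦ (hF i).toLp) l (𝓝 hf.toLp) := by
  rcases l.eq_or_neBot with rfl | hl
  · exact tendsto_bot
  rw [Lp.tendsto_Lp_iff_tendsto_eLpNorm'']
  have hfg : ∀ᵐ x ∂μ, ‖f x‖ ≤ g x := by
    -- The index set may be uncountable; a sequence leaves only countably many null sets to discard.
    obtain ⟨u, hu⟩ := l.exists_seq_tendsto
    filter_upwards [hlim, ae_all_iff.2 fun n ↦ hFg (u n)] with x hx hn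
    exact le_of_tendsto (hx.comp hu).norm (Eventually.of_forall hn)
  have h2 : (fun i ↦ eLpNorm (F i - f) 2 μ) =
      fun i ↦ (∫⁻ x, ‖F i x - f x‖ₑ ^ (2 : ℝ) ∂μ) ^ (1 / (2 : ℝ)) := by
    funext i
    rw [eLpNorm_eq_lintegral_rpow_enorm_toReal two_ne_zero ENNReal.ofNat_ne_top]
    simp
  rw [h2]
  have h3 : Tendsto (fun i ↦ ∫⁻ x, ‖F i x - f x‖ₑ ^ (2 : ℝ) ∂μ) l (𝓝 (∫⁻ _, 0 ∂μ)) := by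
    refine tendsto_lintegral_filter_of_dominated_convergence'
      (fun x ↦ ‖2 * g x‖ₑ ^ (2 : ℝ)) ?_ ?_ ?_ ?_
    · exact Eventually.of_forall fun i ↦ (((hF i).1.sub hf.1).enorm.pow_const _)
    · refine Eventually.of_forall fun i ↦ ?_
      filter_upwards [hFg i, hfg] with x h1 h2
      refine ENNReal.rpow_le_rpow ?_ two_pos.le
      rw [← ofReal_norm, ← ofReal_norm]
      refine ENNReal.ofReal_le_ofReal ((norm_sub_le _ _).trans ?_)
      rw [Real.norm_of_nonneg (by linarith [norm_nonneg (f x)])]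
      linarith
    · have := (hg.const_mul 2).2
      rw [eLpNorm_eq_lintegral_rpow_enorm_toReal two_ne_zero ENNReal.ofNat_ne_top] at this
      have h4 := ENNReal.rpow_lt_top_iff_of_pos (by simp) |>.1 this
      simpa using h4.ne
    · filter_upwards [hlim] with x hx
      have h5 : Tendsto (fun i ↦ ‖F i x - f x‖ₑ) l (𝓝 0) := by
        have := (hx.sub_const (f x)).enorm
        simpa using this
      have := (ENNReal.continuous_rpow_const (y := (2 : ℝ))).tendsto 0 |>.comp h5
      simpa [Function.comp_def] using this
  have := (ENNReal.continuous_rpow_const (y := 1 / (2 : ℝ))).tendsto _ |>.comp h3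
  simpa [Function.comp_def] using this

theorem tendsto_rayDensity {s a α : ℝ} (ha : 0 < a) (hα : α ≠ 0) (hs : s < 1 / 2 - a)
    (h : 𝓢(ℝ, ℂ)) {ι : Type*} {l : Filter ι} [l.IsCountablyGenerated] {m : ι → ℝ → ℂ}
    {m₀ : ℝ → ℂ} {B : ℝ} (hm : ∀ i, Measurable (m i)) (hm₀ : Measurable m₀)
    (hB : ∀ i, ∀ᵐ r ∂(rieszMeasure a), ‖m i r‖ ≤ B)
    (hB₀ : ∀ᵐ r ∂(rieszMeasure a), ‖m₀ r‖ ≤ B)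
    (hlim : ∀ᵐ r ∂(rieszMeasure a), Tendsto (fun i ↦ m i r) l (𝓝 (m₀ r))) :
    Tendsto (fun i ↦ (memLp_rayDensity ha hα hs h (hm i) (hB i)).toLp) l
      (𝓝 (memLp_rayDensity ha hα hs h hm₀ hB₀).toLp) := by
  obtain ⟨g, hg, hgm⟩ := exists_norm_rayDensity_le ha hα hs h B
  obtain ⟨C, hC, hh⟩ := integral_norm_ray_le ha hα h
  refine tendsto_toLp_of_dominated _ _ hg (fun i ↦ Eventually.of_forall (hgm _ (hB i)))
    (Eventually.of_forall fun ξ ↦ ?_)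
  refine Tendsto.const_mul _ ?_
  refine tendsto_integral_filter_of_dominated_convergence (fun r ↦ B * ‖h (r * α - ξ)‖) ?_ ?_
    ((hh ξ).1.norm.const_mul B) ?_
  · exact Eventually.of_forall fun i ↦ (hm i).aestronglyMeasurable.mul (hh ξ).1.1
  · refine Eventually.of_forall fun i ↦ ?_
    filter_upwards [hB i] with r hr
    rw [norm_mul]
    exact mul_le_mul_of_nonneg_right hr (norm_nonneg _)
  · filter_upwards [hlim] with r hr
    exact hr.mul_const _

theorem integrable_translate_mul {a α : ℝ} (ha : 0 < a) (hα : α ≠ 0) (g h : 𝓢(ℝ, ℂ))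
    {m : ℝ → ℂ} (hm : Measurable m) {B : ℝ} (hB : ∀ᵐ r ∂(rieszMeasure a), ‖m r‖ ≤ B) :
    Integrable (fun q : ℝ × ℝ ↦ m q.1 * (g q.2 * h (q.1 * α - q.2)))
      ((rieszMeasure a).prod volume) := by
  obtain ⟨l, hl⟩ := exists_integrable_weight (volume : Measure ℝ)
  have := rayMeasure_hasTemperateGrowth ha hα
  obtain ⟨k, hk⟩ := exists_integrable_weight (rayMeasure a α)
  have hk' : Integrable (fun r : ℝ ↦ weight k (r * α)) (rieszMeasure a) := by
    have h := hk k le_rfl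
    rwa [rayMeasure, (measurableEmbedding_smul_left hα).integrable_map_iff] at h
  obtain ⟨C, hC, hg⟩ := exists_norm_le_weight g (k + l)
  obtain ⟨D, hD, hh⟩ := exists_norm_le_weight h k
  refine ((hk'.mul_prod (hl l le_rfl)).const_mul (|B| * (C * D))).mono' ?_ ?_
  · have h1 : Continuous fun q : ℝ × ℝ ↦ g q.2 * h (q.1 * α - q.2) :=
      (g.continuous.comp continuous_snd).mul (h.continuous.comp (by fun_prop))
    exact ((hm.comp measurable_fst).mul h1.measurable).aestronglyMeasurable
  · filter_upwards [Measure.quasiMeasurePreserving_fst.ae hB] with q hq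
    have h1 := weight_sub_le k q.2 (q.1 * α)
    have h2 : weight (k + l) q.2 * (1 + ‖q.2‖) ^ k = weight l q.2 := by
      rw [weight_add, weight]
      field_simp
    rw [norm_mul, norm_mul]
    calc ‖m q.1‖ * (‖g q.2‖ * ‖h (q.1 * α - q.2)‖)
        ≤ |B| * ((C * weight (k + l) q.2) *
          (D * ((1 + ‖q.2‖) ^ k * weight k (q.1 * α)))) := by
          refine mul_le_mul (hq.trans (le_abs_self B)) ?_ (by positivity) (abs_nonneg B)
          exact mul_le_mul (hg _) ((hh _).trans (mul_le_mul_of_nonneg_left h1 hD))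
            (norm_nonneg _) (mul_nonneg hC (weight_nonneg _ _))
      _ = |B| * (C * D) * (weight k (q.1 * α) * weight l q.2) := by
          rw [← h2]
          ring

/-- Multiplication by ψ convolves the spectrum with `𝓕⁻ ψ` reflected, and the Bessel potential
inserts (1+ξ²)^(s/2). Hence the Fourier transform of the left side is K times the ray density, and
membership in H^s reduces to an L² bound. -/
theorem besselPotential_smulLeft_ray {s a α : ℝ} (ha : 0 < a) (hα : α ≠ 0) (hs : s < 1 / 2 - a)
    (ψ : 𝓢(ℝ, ℂ)) {m : ℝ → ℂ} (hm : Measurable m) {B : ℝ}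
    (hB : ∀ᵐ r ∂(rieszMeasure a), ‖m r‖ ≤ B) (K : ℂ) {T : 𝓢'(ℝ, ℂ)}
    (hT : ∀ φ, T φ = K * ∫ r : ℝ, m r * 𝓕⁻ φ (r * α) ∂(rieszMeasure a)) :
    besselPotential ℝ ℂ s (smulLeftCLM ℂ ψ T) =
      ((K • 𝓕⁻ (memLp_rayDensity ha hα hs (𝓕⁻ ψ) hm hB).toLp : Lp ℂ 2 (volume : Measure ℝ)) :
        𝓢'(ℝ, ℂ)) := by
  ext φ
  set J : ℝ → ℂ := fun ξ ↦ (((1 + ‖ξ‖ ^ 2) ^ (s / 2) : ℝ) : ℂ) with hJdef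
  have hJ : J.HasTemperateGrowth := by fun_prop
  set g := SchwartzMap.smulLeftCLM ℂ J (𝓕⁻ φ) with hg
  have hint := integrable_translate_mul ha hα g (𝓕⁻ ψ) hm hB
  have hL : besselPotential ℝ ℂ s (smulLeftCLM ℂ ψ T) φ =
      K * ∫ r : ℝ, (∫ ξ : ℝ, m r * (g ξ * 𝓕⁻ ψ (r * α - ξ))) ∂(rieszMeasure a) := by
    change T (SchwartzMap.smulLeftCLM ℂ ψ (𝓕 g)) = _
    rw [hT]
    congr 2
    ext r
    rw [fourierInv_smulLeft, FourierTransform.fourierInv_fourier_eq, integral_const_mul,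
      ← integral_sub_left_eq_self _ volume (r * α)]
    simp_rw [sub_sub_cancel, mul_comm (𝓕⁻ ψ _)]
  rw [hL, ← FourierTransform.fourierInv_smul, ← Lp.fourierInv_toTemperedDistribution_eq,
    TemperedDistribution.fourierInv_apply, Lp.toTemperedDistribution_apply,
    integral_integral_swap hint, ← integral_const_mul]
  refine integral_congr_ae ?_
  filter_upwards [Lp.coeFn_smul K (memLp_rayDensity ha hα hs (𝓕⁻ ψ) hm hB).toLp,
    (memLp_rayDensity ha hα hs (𝓕⁻ ψ) hm hB).coeFn_toLp] with ξ h1 h2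
  rw [h1, Pi.smul_apply, h2, hg, SchwartzMap.smulLeftCLM_apply_apply hJ, rayDensity]
  simp_rw [smul_eq_mul, mul_left_comm (m _), integral_const_mul]
  ring

/-- The phase `r ↦ exp(2πi r β t)`. -/
def phase (β t r : ℝ) : ℂ := Complex.exp (2 * Real.pi * Complex.I * (r * (β * t) : ℝ))

theorem norm_phase (β t r : ℝ) : ‖phase β t r‖ = 1 := by simp [phase, Complex.norm_exp]

theorem measurable_phase (β t : ℝ) : Measurable (phase β t) :=
  Continuous.measurable (by unfold phase; fun_prop)

theorem hasDerivAt_phase (β t r : ℝ) :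
    HasDerivAt (fun t ↦ phase β t r) (2 * Real.pi * Complex.I * (r * β) * phase β t r) t := by
  have h : HasDerivAt (fun t : ℝ ↦ 2 * Real.pi * Complex.I * ((r * (β * t) : ℝ) : ℂ))
      (2 * Real.pi * Complex.I * ((r * (β * 1) : ℝ) : ℂ)) t :=
    (((hasDerivAt_id t).const_mul β).const_mul r).ofReal_comp.const_mul _
  refine h.cexp.congr_deriv ?_
  rw [phase]
  push_cast
  ring

theorem norm_phase_sub_le (β t t₀ r : ℝ) :
    ‖phase β t r - phase β t₀ r‖ ≤ 2 * Real.pi * |β| * |r| * |t - t₀| := by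
  have hpi := Real.pi_pos
  refine Convex.norm_image_sub_le_of_norm_hasDerivWithin_le (s := Set.univ)
    (f := fun t ↦ phase β t r) (fun x _ ↦ (hasDerivAt_phase β x r).hasDerivWithinAt)
    (fun x _ ↦ ?_) convex_univ trivial trivial
  simp only [norm_mul, norm_phase, Complex.norm_real, Complex.norm_I, Real.norm_eq_abs,
    abs_of_pos hpi, RCLike.norm_ofNat]
  exact le_of_eq (by ring)

theorem continuousIntoHloc_of_ray {s a α β : ℝ} (ha : 0 < a) (hα : α ≠ 0) (hs : s < 1 / 2 - a)
    (K : ℂ) (I : Set ℝ) {U : ℝ → 𝓢'(ℝ, ℂ)}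
    (hU : ∀ t φ, U t φ = K * ∫ r : ℝ, phase β t r * 𝓕⁻ φ (r * α) ∂(rieszMeasure a)) :
    ContinuousIntoHloc s I U := by
  intro ψ hψ hψc
  have hB (t : ℝ) : ∀ᵐ r ∂(rieszMeasure a), ‖phase β t r‖ ≤ 1 :=
    Eventually.of_forall fun r ↦ (norm_phase β t r).le
  refine ⟨fun t ↦ K • 𝓕⁻ (memLp_rayDensity ha hα hs (𝓕⁻ (hψc.toSchwartzMap hψ))
    (measurable_phase β t) (hB t)).toLp, ?_, fun t _ ↦
      besselPotential_smulLeft_ray ha hα hs (hψc.toSchwartzMap hψ) (measurable_phase β t) (hB t) K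
        (hU t)⟩
  refine Continuous.continuousOn (continuous_iff_continuousAt.2 fun t₀ ↦ ?_)
  have h := tendsto_rayDensity ha hα hs (𝓕⁻ (hψc.toSchwartzMap hψ)) (l := 𝓝 t₀)
    (fun t ↦ measurable_phase β t) (measurable_phase β t₀) hB (hB t₀)
    (Eventually.of_forall fun r ↦ (hasDerivAt_phase β t₀ r).continuousAt)
  exact (((FourierTransform.continuous_fourierInv (E := Lp ℂ 2 (volume : Measure ℝ))).tendsto
    _).comp h).const_smul K

/-- The difference quotient of the phase, divided by `r`. -/
def phaseSlope (β t₀ t r : ℝ) : ℂ := (phase β t r - phase β t₀ r) / ((t - t₀ : ℝ) * r)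

theorem measurable_phaseSlope (β t₀ t : ℝ) : Measurable (phaseSlope β t₀ t) :=
  ((measurable_phase β t).sub (measurable_phase β t₀)).div
    (measurable_const.mul Complex.measurable_ofReal)

/-- Dividing by r makes the multiplier bounded uniformly in t and r, also for t = t₀ or r = 0, where
the quotient is 0. -/
theorem norm_phaseSlope_le (β t₀ t r : ℝ) : ‖phaseSlope β t₀ t r‖ ≤ 2 * Real.pi * |β| := by
  have hpi := Real.pi_pos
  rw [phaseSlope, norm_div, norm_mul, Complex.norm_real, Complex.norm_real, Real.norm_eq_abs,
    Real.norm_eq_abs]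
  refine div_le_of_le_mul₀ (by positivity) (by positivity)
    ((norm_phase_sub_le β t t₀ r).trans (le_of_eq (by ring)))

theorem tendsto_phaseSlope (β t₀ : ℝ) {r : ℝ} (hr : 0 < r) :
    Tendsto (fun t ↦ phaseSlope β t₀ t r) (𝓝[≠] t₀)
      (𝓝 (2 * Real.pi * Complex.I * β * phase β t₀ r)) := by
  have hr' : (r : ℂ) ≠ 0 := by exact_mod_cast hr.ne'
  have h := (hasDerivAt_iff_tendsto_slope.1 (hasDerivAt_phase β t₀ r)).div_const (r : ℂ)
  convert h using 2 with t
  · rw [slope_def_module, phaseSlope, Complex.real_smul, Complex.ofReal_inv, ← div_eq_inv_mul,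
      div_div]
  · field_simp

/-- The factor r missing from `phaseSlope` is absorbed in the measure, which moves from a to a + 1.
For t = t₀ both sides are 0 by the convention on division. -/
theorem integral_phase_sub {a α : ℝ} (ha : 0 < a) (hα : α ≠ 0) (h : 𝓢(ℝ, ℂ)) (β ξ t₀ t : ℝ) :
    ((t - t₀ : ℝ) : ℂ)⁻¹ * ((∫ r : ℝ, phase β t r * h (r * α - ξ) ∂(rieszMeasure a)) -
        ∫ r : ℝ, phase β t₀ r * h (r * α - ξ) ∂(rieszMeasure a)) =
      a * ∫ r : ℝ, phaseSlope β t₀ t r * h (r * α - ξ) ∂(rieszMeasure (a + 1)) := by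
  obtain ⟨C, -, hh⟩ := integral_norm_ray_le ha hα h
  have hint (t : ℝ) : Integrable (fun r ↦ phase β t r * h (r * α - ξ)) (rieszMeasure a) := by
    refine (hh ξ).1.mono ((measurable_phase β t).aestronglyMeasurable.mul (hh ξ).1.1)
      (Eventually.of_forall fun r ↦ ?_)
    rw [norm_mul, norm_phase, one_mul]
  rw [← integral_sub (hint t) (hint t₀), ← integral_const_mul]
  have h2 := integral_smul_rieszMeasure ha fun r : ℝ ↦ phaseSlope β t₀ t r * h (r * α - ξ)
  rw [Complex.real_smul] at h2
  rw [← h2]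
  refine integral_congr_ae ?_
  filter_upwards [ae_rieszMeasure_pos a] with r hr
  have hr' : (r : ℂ) ≠ 0 := by exact_mod_cast hr.ne'
  rw [phaseSlope, Complex.real_smul]
  rcases eq_or_ne ((t - t₀ : ℝ) : ℂ) 0 with h0 | h0
  · simp [h0]
  · field_simp

theorem slope_toLp_rayDensity {s a α : ℝ} (ha : 0 < a) (hα : α ≠ 0) (hs : s < 1 / 2 - a)
    (h : 𝓢(ℝ, ℂ)) {β t₀ : ℝ} (hB : ∀ t, ∀ᵐ r ∂(rieszMeasure a), ‖phase β t r‖ ≤ 1) {t : ℝ}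
    (hq : MemLp (rayDensity s (a + 1) α h (phaseSlope β t₀ t)) 2 volume) :
    slope (fun t ↦ (memLp_rayDensity ha hα hs h (measurable_phase β t) (hB t)).toLp) t₀ t =
      (a : ℂ) • hq.toLp := by
  have h1 (c : ℝ) (f : Lp ℂ 2 (volume : Measure ℝ)) : c • f = (c : ℂ) • f :=
    RCLike.real_smul_eq_coe_smul c f
  have hm := fun t ↦ memLp_rayDensity ha hα hs h (measurable_phase β t) (hB t)
  rw [slope_def_module, h1, ← MemLp.toLp_sub (hm t) (hm t₀),
    ← MemLp.toLp_const_smul _ ((hm t).sub (hm t₀)), ← MemLp.toLp_const_smul _ hq]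
  refine MemLp.toLp_congr _ _ (Eventually.of_forall fun ξ ↦ ?_)
  have := integral_phase_sub ha hα h β ξ t₀ t
  simp only [Pi.smul_apply, Pi.sub_apply, rayDensity, smul_eq_mul, ← mul_sub]
  rw [mul_left_comm, Complex.ofReal_inv, this, mul_left_comm]

/-- The difference quotients are ray densities of index a + 1 with bounded, pointwise convergent
multipliers, so they converge in L². The raised index is the reason for the stronger condition on s.
-/
theorem hasDerivIntoHloc_of_ray {s a α β : ℝ} (ha : 0 < a) (hα : α ≠ 0)
    (hs : s < 1 / 2 - (a + 1)) (K : ℂ) (I : Set ℝ) {U V : ℝ → 𝓢'(ℝ, ℂ)}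
    (hU : ∀ t φ, U t φ = K * ∫ r : ℝ, phase β t r * 𝓕⁻ φ (r * α) ∂(rieszMeasure a))
    (hV : ∀ t φ, V t φ = K * (2 * Real.pi * Complex.I * β * a) *
      ∫ r : ℝ, phase β t r * 𝓕⁻ φ (r * α) ∂(rieszMeasure (a + 1))) :
    HasDerivIntoHloc s I U V := by
  intro ψ hψ hψc
  have ha1 : 0 < a + 1 := by linarith
  have hs' : s < 1 / 2 - a := by linarith
  set h := 𝓕⁻ (hψc.toSchwartzMap hψ) with hh
  have hB (b t : ℝ) : ∀ᵐ r ∂(rieszMeasure b), ‖phase β t r‖ ≤ 1 :=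
    Eventually.of_forall fun r ↦ (norm_phase β t r).le
  refine ⟨fun t ↦ K • 𝓕⁻ (memLp_rayDensity ha hα hs' h (measurable_phase β t) (hB a t)).toLp,
    fun t ↦ (K * (2 * Real.pi * Complex.I * β * a)) • 𝓕⁻ (memLp_rayDensity ha1 hα hs h
      (measurable_phase β t) (hB (a + 1) t)).toLp, fun t _ ↦
      besselPotential_smulLeft_ray ha hα hs' (hψc.toSchwartzMap hψ) (measurable_phase β t)
        (hB a t) K (hU t), fun t _ ↦
      besselPotential_smulLeft_ray ha1 hα hs (hψc.toSchwartzMap hψ) (measurable_phase β t)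
        (hB (a + 1) t) _ (hV t),
      fun t₀ _ ↦ ?_⟩
  refine HasDerivAt.hasDerivWithinAt (hasDerivAt_iff_tendsto_slope.2 ?_)
  have hq := fun t ↦ memLp_rayDensity ha1 hα hs h (measurable_phaseSlope β t₀ t)
    (Eventually.of_forall (norm_phaseSlope_le β t₀ t))
  have hlim := tendsto_rayDensity ha1 hα hs h (l := 𝓝[≠] t₀) (measurable_phaseSlope β t₀)
    ((measurable_phase β t₀).const_mul (2 * Real.pi * Complex.I * β))
    (fun t ↦ Eventually.of_forall (norm_phaseSlope_le β t₀ t))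
    (Eventually.of_forall fun r ↦ le_of_eq (by
      simp [norm_phase, abs_of_pos Real.pi_pos]))
    (by filter_upwards [ae_rieszMeasure_pos (a + 1)] with r hr using tendsto_phaseSlope β t₀ hr)
  let Φ : Lp ℂ 2 (volume : Measure ℝ) →L[ℂ] Lp ℂ 2 (volume : Measure ℝ) :=
    K • FourierTransform.fourierInvCLM ℂ (Lp ℂ 2 (volume : Measure ℝ))
  have hΦ (f : Lp ℂ 2 (volume : Measure ℝ)) : Φ f = K • 𝓕⁻ f := rfl
  have h2 := (Φ.continuous.tendsto _).comp (hlim.const_smul (a : ℂ))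
  refine (h2.congr fun t ↦ ?_).trans (le_of_eq (congrArg 𝓝 ?_))
  · have h3 := slope_toLp_rayDensity ha hα hs' h (t₀ := t₀) (t := t) (hB a) (hq t)
    rw [Function.comp_apply, ← h3]
    simp only [slope_def_module]
    rw [ContinuousLinearMap.map_smul_of_tower, map_sub]
    rfl
  · rw [← MemLp.toLp_const_smul, hΦ]
    beta_reduce
    rw [mul_smul]
    congr 1
    rw [← FourierTransform.fourierInv_smul, ← MemLp.toLp_const_smul _
      (memLp_rayDensity ha1 hα hs h (measurable_phase β t₀) (hB (a + 1) t₀))]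
    congr 1
    refine MemLp.toLp_congr _ _ (Eventually.of_forall fun ξ ↦ ?_)
    simp only [Pi.smul_apply, rayDensity, smul_eq_mul, mul_assoc, integral_const_mul]
    ring

/-! ### The travelling waves -/

theorem isXPlusI0Pow_homogeneousWave {a : ℝ} (ha : 0 < a) :
    IsXPlusI0Pow (-a) (waveConst a • homogeneousWave a (1 : ℝ)) := by
  intro φ
  have h := tendsto_integral_mul_cpow ha (one_ne_zero (α := ℝ)) φ
  simpa using h

theorem boostedProfile_zero {a c e : ℝ} (ha : 0 < a) (hα : e / √|1 - c ^ 2| ≠ 0) (A K : ℂ) :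
    boostedProfile c e A (K • homogeneousWave a (1 : ℝ)) 0 =
      (A * K) • homogeneousWave a (e / √|1 - c ^ 2|) := by
  ext φ
  rw [boostedProfile_homogeneousWave_apply ha hα]
  change _ = A * K * homogeneousWave a _ φ
  rw [homogeneousWave_apply ha hα]
  simp

theorem inner_boost (c e γ : ℝ) (z : Spacetime) :
    inner ℝ z !₂[e / γ, c / γ] = (e * z 0 + c * z 1) / γ := by
  simp [PiLp.inner_apply, Fin.sum_univ_two]
  ring

/-- `hpa` matches the index p a of the power with the index a + 2 of the second derivatives; `hK`
then equates the coefficients, after division by K. -/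
theorem solvesWaveEquation_homogeneousWave {a α β σ : ℝ} (ha : 0 < a) {p : ℕ} (hp : 2 ≤ p)
    (hpa : p * a = a + 2) {K : ℂ}
    (hv : (!₂[α, β] : Spacetime) ≠ 0)
    (hK : σ * K ^ (p - 1) = (4 * Real.pi ^ 2 * (α ^ 2 - β ^ 2) * (a * (a + 1)) : ℝ)) :
    SolvesWaveEquation σ p (K • homogeneousWave a !₂[α, β]) := by
  obtain ⟨k, rfl⟩ : ∃ k, p = k + 1 := ⟨p - 1, by omega⟩
  have h := isPower_homogeneousWave ha hv K k
  refine ⟨_, h, ?_⟩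
  rw [hpa, lineDerivOp_lineDerivOp_homogeneousWave ha hv,
    lineDerivOp_lineDerivOp_homogeneousWave ha hv]
  have hT : inner ℝ (!₂[α, β] : Spacetime) eT = β := by
    simp [PiLp.inner_apply]
  have hX : inner ℝ (!₂[α, β] : Spacetime) eX = α := by
    simp [PiLp.inner_apply]
  rw [Nat.add_sub_cancel] at hK
  rw [hT, hX]
  ext φ
  change -K * _ * homogeneousWave (a + 2) !₂[α, β] φ -
    -K * _ * homogeneousWave (a + 2) !₂[α, β] φ =
      σ * (K ^ (k + 1) * homogeneousWave (a + 2) !₂[α, β] φ)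
  have hpow : σ * (K ^ (k + 1) * homogeneousWave (a + 2) !₂[α, β] φ) =
      σ * K ^ k * K * homogeneousWave (a + 2) !₂[α, β] φ := by ring
  rw [hpow, hK]
  push_cast
  ring

end AnomalousWave

end

open AnomalousWave in
theorem mainTheorem5 (c : ℝ) (hc : c ≠ 1) (hc' : c ≠ -1) (p : ℕ) (hp : 2 ≤ p)
    (σ : ℝ) (hσ : σ = 1 ∨ σ = -1) (e : ℝ) (he : e = 1 ∨ e = -1) :
    ∃ u₀ : 𝓢'(ℝ, ℂ), IsXPlusI0Pow (2 / (1 - (p : ℝ))) u₀ ∧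
      ∃ A : ℂ, A ≠ 0 ∧ ∃ u : 𝓢'(Spacetime, ℂ),
        HasTimeSlices u (boostedProfile c e A u₀) ∧
        SolvesWaveEquation σ p u ∧
        singularSupport u = {z : Spacetime | e * z 0 + c * z 1 = 0} ∧
        singularSupport (boostedProfile c e A u₀ 0) = {0} ∧
        ∀ s : ℝ, s < 1 / 2 - 2 / ((p : ℝ) - 1) → ∀ T : ℝ, 0 < T →
          ContinuousIntoHloc s (Set.Icc (-T) T) (boostedProfile c e A u₀) ∧
          C1IntoHloc (s - 1) (Set.Icc (-T) T) (boostedProfile c e A u₀)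
            (boostedProfile c e (A * (c / √|1 - c ^ 2| : ℝ)) (derivCLM ℂ u₀)) := by
  have hp1 : (0 : ℝ) < p - 1 := by
    have : (2 : ℝ) ≤ p := by exact_mod_cast hp
    linarith
  have h1c : 1 - c ^ 2 ≠ 0 := by
    intro h
    rcases mul_self_eq_one_iff.1 (show c * c = 1 by linarith) with h | h
    exacts [hc h, hc' h]
  have hγ : 0 < √|1 - c ^ 2| := Real.sqrt_pos.2 (abs_pos.2 h1c)
  have he0 : e ≠ 0 := by rcases he with rfl | rfl <;> norm_num
  have he2 : e ^ 2 = 1 := by rcases he with rfl | rfl <;> norm_num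
  have hσ2 : σ * σ = 1 := by rcases hσ with rfl | rfl <;> norm_num
  have hα : e / √|1 - c ^ 2| ≠ 0 := div_ne_zero he0 hγ.ne'
  set μ : ℝ := 2 / ((p : ℝ) - 1) with hμdef
  have hμ : 0 < μ := by positivity
  have hpμ : p * μ = μ + 2 := by rw [hμdef]; field_simp; ring
  set α := e / √|1 - c ^ 2| with hαdef
  set β := c / √|1 - c ^ 2| with hβdef
  have hv : (!₂[α, β] : Spacetime) ≠ 0 := fun h ↦ hα (by simpa using congrArg (fun z ↦ z 0) h)
  have hαβ : α ^ 2 - β ^ 2 ≠ 0 := by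
    rw [hαdef, hβdef, div_pow, div_pow, he2, ← sub_div]
    exact div_ne_zero h1c (by positivity)
  -- The amplitude equation multiplied by σ = σ⁻¹. The signs of σ and of 1 - c² do not matter, since
  -- roots are taken in ℂ.
  obtain ⟨K, hK⟩ := IsAlgClosed.exists_pow_nat_eq
    ((σ * (4 * Real.pi ^ 2 * (α ^ 2 - β ^ 2) * (μ * (μ + 1))) : ℝ) : ℂ)
    (show 0 < p - 1 by omega)
  have hσK : σ * K ^ (p - 1) = (4 * Real.pi ^ 2 * (α ^ 2 - β ^ 2) * (μ * (μ + 1)) : ℝ) := by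
    rw [hK, ← Complex.ofReal_mul, ← mul_assoc, hσ2, one_mul]
  have hK0 : K ≠ 0 := by
    rintro rfl
    rw [zero_pow (by omega), mul_zero, eq_comm, Complex.ofReal_eq_zero] at hσK
    have := Real.pi_ne_zero
    have : μ * (μ + 1) ≠ 0 := by positivity
    simp_all
  have hW := waveConst_ne_zero μ
  set u₀ := waveConst μ • homogeneousWave μ (1 : ℝ) with hu₀
  have hAW : K / waveConst μ * waveConst μ = K := div_mul_cancel₀ K hW
  have hU (t : ℝ) (φ : 𝓢(ℝ, ℂ)) : boostedProfile c e (K / waveConst μ) u₀ t φ =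
      K * ∫ r : ℝ, phase β t r * 𝓕⁻ φ (r * α) ∂(rieszMeasure μ) := by
    rw [hu₀, boostedProfile_homogeneousWave_apply hμ hα, hAW]
    rfl
  have hV (t : ℝ) (φ : 𝓢(ℝ, ℂ)) :
      boostedProfile c e (K / waveConst μ * (β : ℝ)) (derivCLM ℂ u₀) t φ =
      K * (2 * Real.pi * Complex.I * β * μ) *
        ∫ r : ℝ, phase β t r * 𝓕⁻ φ (r * α) ∂(rieszMeasure (μ + 1)) := by
    rw [hu₀, map_smul, derivCLM_homogeneousWave hμ, smul_smul,
      boostedProfile_homogeneousWave_apply (by positivity) hα]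
    change _ * (∫ r : ℝ, phase β t r * 𝓕⁻ φ (r * α) ∂(rieszMeasure (μ + 1))) = _
    congr 1
    field_simp
  -- Dividing by `waveConst μ` compensates the normalisation of `u₀`, so that u has amplitude
  -- exactly K.
  refine ⟨u₀, ?_, K / waveConst μ, div_ne_zero hK0 hW, K • homogeneousWave μ !₂[α, β],
    hasTimeSlices_homogeneousWave hμ hα K hU,
    solvesWaveEquation_homogeneousWave hμ hp hpμ hv hσK, ?_, ?_, fun s hs T _ ↦ ⟨?_, ?_, ?_⟩⟩
  · have : 2 / (1 - (p : ℝ)) = -μ := by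
      rw [hμdef, ← neg_sub, div_neg]
    rw [this]
    exact isXPlusI0Pow_homogeneousWave hμ
  · rw [singularSupport_homogeneousWave hμ hv hK0]
    ext z
    simp only [Set.mem_ofPred_eq]
    rw [hαdef, hβdef, inner_boost, div_eq_zero_iff, or_iff_left hγ.ne']
  · rw [hu₀, boostedProfile_zero hμ hα, hAW, singularSupport_homogeneousWave hμ hα hK0]
    ext x
    have : inner ℝ x α = 0 ↔ x = 0 := by simp [hα]
    simpa using this
  · exact continuousIntoHloc_of_ray hμ hα hs K _ hU
  · exact hasDerivIntoHloc_of_ray hμ hα (by linarith) K _ hU hV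
  · exact continuousIntoHloc_of_ray (by positivity) hα (by linarith) _ _ hV
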